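/- Let $\mathfrak h$ be a finite-dimensional complex vector space, $\Phi\subset\mathfrak h^*$ a (finite) reduced crystallographic root system spanning $\mathfrak h^*$, with Weyl group $W$, coroots $\alpha^\vee\in\mathfrak h$, and a base of simple roots $\alpha_i$ with positive roots $\Phi^+$. Let $(\cdot|\cdot)$ be a nondegenerate symmetric $W$-invariant bilinear form on $\mathfrak h$, $\pi:\mathfrak h\to\mathfrak h^*$ the induced isomorphism, $(\cdot|\cdot)$ also the transported form on $\mathfrak h^*$, and $x_{\alpha^\vee}=\pi(\alpha^\vee)$. The degenerate affine Hecke algebra $\mathcal H'$ is the $\mathbb C$-algebra generated by central parameters $k_\alpha$ $(\alpha\in\Phi)$ with $k_{w\alpha}=k_\alpha$, by $\mathbb CW$, and by $S\mathfrak h$ (with linear generators $x(u)$, $u\in\mathfrak h$), subject to $s_ix(u)-x(s_iu)s_i=k_{\alpha_i}\alpha_i(u)$ for all simple reflections $s_i$. The rational Cherednik algebra $H_{\hbar,c}$ is the $\mathbb C$-algebra generated by central parameters $\hbar$ and $c_\alpha$ with $c_{w\alpha}=c_\alpha$, and by $\mathbb CW\ltimes T(\mathfrak h\oplus\mathfrak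 h^*)$ (write $y(u)$ for $u\in\mathfrak h$ as an element of it), subject to $[x,x']=0$, $[y,y']=0$ and $[y,x]=\hbar\langle y,x\rangle-\sum_{\alpha\in\Phi^+}c_\alpha\langle\alpha,y\rangle\langle\alpha^\vee,x\rangle s_\alpha$ for $x,x'\in\mathfrak h^*$, $y,y'\in\mathfrak h$. It is graded by $\deg x=\deg y=1$, $\deg w=0$, $\deg\hbar=\deg c_\alpha=2$, and $\widehat H_{\hbar,c}$ is its completion with respect to this grading. **Theorem.** There is a homomorphism of $\mathbb C$-algebras $\varphi:\mathcal H'\to\widehat H_{\hbar,c}$ such that $\varphi(w)=w$ for $w\in W$, $\varphi(k_\alpha)=-\dfrac{2c_\alpha}{(\alpha|\alpha)}$ for $\alpha\in\Phi$, and, for $u\in\mathfrak h$, $$2\pi i\,\varphi(x(u))=-y(u)-\sum_{\alpha\in\Phi^+}\alpha(u)\,\frac{2c_\alpha}{(\alpha|\alpha)}\left(\frac{2\pi i\,e^{2\pi i x_{\alpha^\vee}}}{e^{2\pi i x_{\alpha^\vee}}-1}-\frac1{x_{\alpha^\vee}}\right)s_\alpha ,$$ where the bracket is understood as a power series in $x_{\alpha^\vee}$.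 Moreover, $\varphi$ arises by degeneration of the elliptic KZ connection. Suppose that $\Phi$ has a highest root $\tilde\alpha$ (that is, $\Phi$ is irreducible) and that $(\tilde\alpha^\vee|\tilde\alpha^\vee)=2$; let $h^\vee$ be the dual Coxeter number (one plus the sum of the coefficients of $\tilde\alpha^\vee$ in the simple coroots). For $\operatorname{Im}\tau>0$ let $\theta(z|\tau)$ be the odd theta function with zero set $\mathbb Z+\mathbb Z\tau$ and $\theta'(0|\tau)=1$, $$\theta(z|\tau)=\frac{e^{\pi iz}-e^{-\pi iz}}{2\pi i}\prod_{s\ge1}\frac{(1-q^se^{2\pi iz})(1-q^se^{-2\pi iz})}{(1-q^s)^2},\qquad q=e^{2\pi i\tau},$$ let $k(z,x|\tau)=\frac{\theta(z+x|\tau)}{\theta(z|\tau)\theta(x|\tau)}-\frac1x$, expanded as a power series in $x$, and put $t_\alpha=\frac{\hbar}{h^\vee}-\frac{2c_\alpha}{(\alpha|\alpha)}s_\alpha$. Then for every $z\in\mathfrak h$ with $e^{2\pi i\alpha(z)}\ne1$ for all $\alpha\in\Phi$, and every $u\in\mathfrak h$, the coefficient $$\sum_{\alpha\in\Phi^+}\alpha(u)\,k\!\left(\alpha(z),\operatorname{ad}\tfrac{x_{\alpha^\vee}}2\,\Big|\,\tau\right)(t_\alpha)-y(u)$$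 of the elliptic KZ connection converges, as $\operatorname{Im}\tau\to\infty$, to $$\varphi\left(\sum_{\alpha\in\Phi^+}\frac{2\pi i\,\alpha(u)}{e^{2\pi i\alpha(z)}-1}\,k_\alpha s_\alpha+2\pi i\,x(u)\right)+\sum_{\alpha\in\Phi^+}\alpha(u)\,\frac{e^{2\pi i\alpha(z)}+1}{e^{2\pi i\alpha(z)}-1}\,\frac{\pi i\,\hbar}{h^\vee},$$ that is, to the image under $\varphi$ of the coefficient of the affine KZ connection plus a central term. Convergence means: for every $n$ and every linear functional on the quotient of $H_{\hbar,c}$ by its elements of degree $\ge n$, the values of the functional converge. -/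

import Mathlib

open scoped UpperHalfPlane

set_option linter.unusedSectionVars false

noncomputable section

namespace AffineKZ

/-! ### Power series in one variable -/

/-- `(f - f(0)) / X` for a power series `f`. -/
def divX (f : PowerSeries ℂ) : PowerSeries ℂ :=
  PowerSeries.mk fun n => PowerSeries.coeff (n + 1) f

/-- The complex number `2πi`. -/
def twoPiI : ℂ := 2 * Real.pi * Complex.I

/-- The power series `e^{2πi X}`. -/
def expSeries : PowerSeries ℂ := PowerSeries.rescale twoPiI (PowerSeries.exp ℂ)

/-- The power series `2πi e^{2πi X} / (e^{2πi X} - 1) - 1 / X`, written as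
`X⁻¹ (2πi e^{2πi X} ((e^{2πi X} - 1) / X)⁻¹ - 1)`. -/
def trigSeries : PowerSeries ℂ :=
  divX (PowerSeries.C twoPiI * expSeries * (divX (expSeries - 1))⁻¹ - 1)

/-- The odd theta function `θ(z | τ)` with zero set `ℤ + ℤτ` and `∂θ/∂z (0 | τ) = 1`, through its
product formula, with `u = e^{2πi z}` and `q = e^{2πi τ}`. -/
def theta (z : ℂ) (τ : ℍ) : ℂ :=
  (Complex.exp (twoPiI / 2 * z) - Complex.exp (-(twoPiI / 2 * z))) / twoPiI *
    ∏' s : ℕ, (1 - Complex.exp (twoPiI * τ) ^ (s + 1) * Complex.exp (twoPiI * z)) *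
      (1 - Complex.exp (twoPiI * τ) ^ (s + 1) * Complex.exp (-(twoPiI * z))) /
      (1 - Complex.exp (twoPiI * τ) ^ (s + 1)) ^ 2

/-- The Taylor series at `X = 0` of `X ↦ θ(z + X | τ)`. -/
def thetaSeries (z : ℂ) (τ : ℍ) : PowerSeries ℂ :=
  PowerSeries.mk fun n => iteratedDeriv n (fun w => theta w τ) z / (n.factorial : ℂ)

/-- The expansion at `X = 0` of `k(z, X | τ) = θ(z + X | τ) / (θ(z | τ) θ(X | τ)) - 1 / X`,
for `z ∉ ℤ + ℤτ`. -/
def kSeries (z : ℂ) (τ : ℍ) : PowerSeries ℂ :=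
  divX (PowerSeries.C (theta z τ)⁻¹ * thetaSeries z τ * (divX (thetaSeries 0 τ))⁻¹ - 1)

section

variable {ι M N : Type*} [Fintype ι] [AddCommGroup M] [Module ℂ M] [AddCommGroup N] [Module ℂ N]
  {P : RootPairing ι ℂ M N} [P.IsCrystallographic] [P.IsReduced] [P.IsRootSystem]

/-! ### Root systems: `M` is the space `𝔥*` of the roots and `N` is `𝔥` -/

variable (P) in
/-- The reflection in the root `α_i` as an element of the Weyl group. -/
abbrev refl (i : ι) : P.weylGroup := RootPairing.weylGroup.ofIdx P i

/-- The action of the Weyl group on `𝔥`, contragredient to its action on `𝔥*`. -/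
def coact (g : P.weylGroup) (u : N) : N :=
  RootPairing.Equiv.coweightEquiv P P (g⁻¹ : P.weylGroup).1 u

open Classical in
/-- The set of positive roots. -/
def posRoots (b : P.Base) : Finset ι := Finset.univ.filter fun i => b.IsPos i

/-- `α_θ` is the highest root: it exceeds every root by a sum of simple roots. -/
def IsHighestRoot (b : P.Base) (θ : ι) : Prop :=
  ∀ i, P.root θ - P.root i ∈ AddSubmonoid.closure (P.root '' b.support)

/-- The dual Coxeter number: one plus the sum of the coefficients of the coroot `α_θ^∨` of the
highest root in the basis of the simple coroots. -/
def dualCoxeter (b : P.Base) (θ : ι) : ℂ :=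
  1 + ∑ j, b.toCoweightBasis.repr (P.coroot θ) j

/-- The isomorphism `π : 𝔥 → 𝔥*` of a nondegenerate form: `⟨π u, v⟩ = (u|v)`. -/
def formIso [FiniteDimensional ℂ N] (P : RootPairing ι ℂ M N) (B : LinearMap.BilinForm ℂ N)
    (hB : B.Nondegenerate) : N ≃ₗ[ℂ] M :=
  (B.toDual hB).trans P.toPerfPair.symm

/-- The number `(α_i|α_i)` for the form on `𝔥*` transported from `𝔥` through `π`. -/
def rootNormSq [FiniteDimensional ℂ N] (P : RootPairing ι ℂ M N) (B : LinearMap.BilinForm ℂ N)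
    (hB : B.Nondegenerate) (i : ι) : ℂ :=
  B ((formIso P B hB).symm (P.root i)) ((formIso P B hB).symm (P.root i))

/-! ### The degenerate affine Hecke algebra -/

/-- Generators of the degenerate affine Hecke algebra: the parameters `k_α`, the elements of the
Weyl group, and `x(u)` for `u ∈ 𝔥`. -/
inductive HeckeGen (P : RootPairing ι ℂ M N) : Type _
  | k (i : ι) : HeckeGen P
  | w (g : P.weylGroup) : HeckeGen P
  | x (u : N) : HeckeGen P

/-- A generator as an element of the free algebra. -/
abbrev hg (a : HeckeGen P) : FreeAlgebra ℂ (HeckeGen P) := FreeAlgebra.ι ℂ a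

/-- Defining relations of the degenerate affine Hecke algebra: the parameters `k_α` are central and
constant on Weyl group orbits, the `w` generate `ℂW`, the `x(u)` generate `S𝔥`, and
`s_i x(u) - x(s_i u) s_i = k_i α_i(u)` for the simple reflections `s_i`. -/
inductive HeckeRel (b : P.Base) :
    FreeAlgebra ℂ (HeckeGen P) → FreeAlgebra ℂ (HeckeGen P) → Prop
  | k_central (i : ι) (a : HeckeGen P) : HeckeRel b (hg (.k i) * hg a) (hg a * hg (.k i))
  | k_invariant (i j : ι) : HeckeRel b (hg (.k (P.reflectionPerm j i))) (hg (.k i))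
  | w_one : HeckeRel b (hg (.w 1)) 1
  | w_mul (g h : P.weylGroup) : HeckeRel b (hg (.w (g * h))) (hg (.w g) * hg (.w h))
  | x_add (u v : N) : HeckeRel b (hg (.x (u + v))) (hg (.x u) + hg (.x v))
  | x_smul (r : ℂ) (u : N) : HeckeRel b (hg (.x (r • u))) (r • hg (.x u))
  | x_comm (u v : N) : HeckeRel b (hg (.x u) * hg (.x v)) (hg (.x v) * hg (.x u))
  | cross (i : ι) (hi : i ∈ b.support) (u : N) :
      HeckeRel b (hg (.w (refl P i)) * hg (.x u) - hg (.x (P.coreflection i u)) * hg (.w (refl P i)))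
        (P.root' i u • hg (.k i))

/-- The degenerate affine Hecke algebra `ℋ'`, over the ring of the parameters `k_α`. -/
def DAHA (b : P.Base) := RingQuot (HeckeRel b)

namespace DAHA

instance (b : P.Base) : Ring (DAHA b) := inferInstanceAs (Ring (RingQuot (HeckeRel b)))

instance (b : P.Base) : Algebra ℂ (DAHA b) := inferInstanceAs (Algebra ℂ (RingQuot (HeckeRel b)))

/-- The quotient map from the free algebra. -/
def mkHom (b : P.Base) : FreeAlgebra ℂ (HeckeGen P) →ₐ[ℂ] DAHA b :=
  RingQuot.mkAlgHom ℂ (HeckeRel b)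

/-- The image of a generator in the degenerate affine Hecke algebra. -/
def gen (b : P.Base) (a : HeckeGen P) : DAHA b := mkHom b (hg a)

/-- The parameter `k_α`. -/
def k (b : P.Base) (i : ι) : DAHA b := gen b (.k i)
/-- The element `w` of the Weyl group. -/
def w (b : P.Base) (g : P.weylGroup) : DAHA b := gen b (.w g)
/-- The element `x(u)`. -/
def x (b : P.Base) (u : N) : DAHA b := gen b (.x u)

end DAHA

/-! ### The rational Cherednik algebra -/

/-- Generators of the rational Cherednik algebra: the parameters `ħ` and `c_α = c_{s_α}`, the
elements of the Weyl group, and the elements of `𝔥*` and of `𝔥`. -/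
inductive CherednikGen (P : RootPairing ι ℂ M N) : Type _
  | hbar : CherednikGen P
  | c (i : ι) : CherednikGen P
  | w (g : P.weylGroup) : CherednikGen P
  | x (ξ : M) : CherednikGen P
  | y (u : N) : CherednikGen P

/-- The degrees of the generators. -/
def CherednikGen.deg : CherednikGen P → ℕ
  | .hbar => 2
  | .c _ => 2
  | .w _ => 0
  | .x _ => 1
  | .y _ => 1

/-- A generator as an element of the free algebra. -/
abbrev cg (a : CherednikGen P) : FreeAlgebra ℂ (CherednikGen P) := FreeAlgebra.ι ℂ a

/-- Defining relations of the rational Cherednik algebra. The parameters `ħ` and `c_α` are central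
and `c_α` is constant on Weyl group orbits; the remaining generators satisfy the relations of
`ℂW ⋉ T(𝔥 ⊕ 𝔥*)`; and `[x, x'] = 0`, `[y, y'] = 0`,
`[y, x] = ħ ⟨y, x⟩ - ∑_{α > 0} c_α ⟨α, y⟩ ⟨α^∨, x⟩ s_α`. -/
inductive CherednikRel (b : P.Base) :
    FreeAlgebra ℂ (CherednikGen P) → FreeAlgebra ℂ (CherednikGen P) → Prop
  | hbar_central (a : CherednikGen P) : CherednikRel b (cg .hbar * cg a) (cg a * cg .hbar)
  | c_central (i : ι) (a : CherednikGen P) : CherednikRel b (cg (.c i) * cg a) (cg a * cg (.c i))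
  | c_invariant (i j : ι) : CherednikRel b (cg (.c (P.reflectionPerm j i))) (cg (.c i))
  | w_one : CherednikRel b (cg (.w 1)) 1
  | w_mul (g h : P.weylGroup) : CherednikRel b (cg (.w (g * h))) (cg (.w g) * cg (.w h))
  | x_add (ξ η : M) : CherednikRel b (cg (.x (ξ + η))) (cg (.x ξ) + cg (.x η))
  | x_smul (r : ℂ) (ξ : M) : CherednikRel b (cg (.x (r • ξ))) (r • cg (.x ξ))
  | y_add (u v : N) : CherednikRel b (cg (.y (u + v))) (cg (.y u) + cg (.y v))
  | y_smul (r : ℂ) (u : N) : CherednikRel b (cg (.y (r • u))) (r • cg (.y u))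
  | w_x (g : P.weylGroup) (ξ : M) :
      CherednikRel b (cg (.w g) * cg (.x ξ)) (cg (.x (g • ξ)) * cg (.w g))
  | w_y (g : P.weylGroup) (u : N) :
      CherednikRel b (cg (.w g) * cg (.y u)) (cg (.y (coact g u)) * cg (.w g))
  | x_comm (ξ η : M) : CherednikRel b (cg (.x ξ) * cg (.x η)) (cg (.x η) * cg (.x ξ))
  | y_comm (u v : N) : CherednikRel b (cg (.y u) * cg (.y v)) (cg (.y v) * cg (.y u))
  | y_x (u : N) (ξ : M) :
      CherednikRel b (cg (.y u) * cg (.x ξ) - cg (.x ξ) * cg (.y u))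
        (P.toLinearMap ξ u • cg .hbar -
          ∑ i ∈ posRoots b, (P.root' i u * P.coroot' i ξ) • (cg (.c i) * cg (.w (refl P i))))

/-- The rational Cherednik algebra `H_{ħ,c}`, over the ring of the parameters `ħ` and `c_α`. -/
def RCA (b : P.Base) := RingQuot (CherednikRel b)

namespace RCA

instance (b : P.Base) : Ring (RCA b) := inferInstanceAs (Ring (RingQuot (CherednikRel b)))

instance (b : P.Base) : Algebra ℂ (RCA b) :=
  inferInstanceAs (Algebra ℂ (RingQuot (CherednikRel b)))

/-- The quotient map from the free algebra. -/
def mkHom (b : P.Base) : FreeAlgebra ℂ (CherednikGen P) →ₐ[ℂ] RCA b :=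
  RingQuot.mkAlgHom ℂ (CherednikRel b)

theorem mkHom_surjective (b : P.Base) : Function.Surjective (mkHom b) :=
  RingQuot.mkAlgHom_surjective ℂ (CherednikRel b)

/-- The image of a generator in the rational Cherednik algebra. -/
def gen (b : P.Base) (a : CherednikGen P) : RCA b := mkHom b (cg a)

/-- The parameter `ħ`. -/
def hbar (b : P.Base) : RCA b := gen b .hbar
/-- The parameter `c_α`. -/
def c (b : P.Base) (i : ι) : RCA b := gen b (.c i)
/-- The element `w` of the Weyl group. -/
def w (b : P.Base) (g : P.weylGroup) : RCA b := gen b (.w g)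
/-- The element `ξ` of `𝔥*`. -/
def x (b : P.Base) (ξ : M) : RCA b := gen b (.x ξ)
/-- The element `u` of `𝔥`. -/
def y (b : P.Base) (u : N) : RCA b := gen b (.y u)

/-- The span of the monomials in the generators of degree at least `n`; since the relations are
homogeneous, this is the sum of the graded pieces of degree at least `n`. -/
def filSpan (b : P.Base) (n : ℕ) : Submodule ℂ (RCA b) :=
  Submodule.span ℂ {a | ∃ l : List (CherednikGen P), n ≤ (l.map CherednikGen.deg).sum ∧
    a = (l.map (gen b)).prod}

theorem mul_mem_filSpan (b : P.Base) {m n : ℕ} {a a' : RCA b} (h : a ∈ filSpan b m)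
    (h' : a' ∈ filSpan b n) : a * a' ∈ filSpan b (m + n) := by
  have hm := Submodule.mul_mem_mul h h'
  rw [filSpan, filSpan, Submodule.span_mul_span] at hm
  refine Submodule.span_mono ?_ hm
  rintro _ ⟨_, ⟨l, hl, rfl⟩, _, ⟨l', hl', rfl⟩, rfl⟩
  exact ⟨l ++ l', by simp only [List.map_append, List.sum_append]; omega, by simp⟩

theorem filSpan_anti (b : P.Base) {m n : ℕ} (h : m ≤ n) : filSpan b n ≤ filSpan b m :=
  Submodule.span_mono fun _ ⟨l, hl, ha⟩ => ⟨l, h.trans hl, ha⟩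

theorem gen_mem_filSpan (b : P.Base) (a : CherednikGen P) : gen b a ∈ filSpan b a.deg :=
  Submodule.subset_span ⟨[a], by simp, by simp⟩

theorem mem_filSpan_zero (b : P.Base) (a : RCA b) : a ∈ filSpan b 0 := by
  obtain ⟨f, rfl⟩ := mkHom_surjective b a
  have hone : (1 : RCA b) ∈ filSpan b 0 := Submodule.subset_span ⟨[], by simp, by simp⟩
  induction f using FreeAlgebra.induction with
  | grade0 r =>
    rw [AlgHom.commutes, Algebra.algebraMap_eq_smul_one]
    exact Submodule.smul_mem _ _ hone
  | grade1 a => exact filSpan_anti b (Nat.zero_le _) (gen_mem_filSpan b a)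
  | mul a a' h h' =>
    have := mul_mem_filSpan b h h'
    rwa [← map_mul] at this
  | add a a' h h' => rw [map_add]; exact Submodule.add_mem _ h h'

/-- The two-sided ideal of elements of degree at least `n`. -/
def fil (b : P.Base) (n : ℕ) : Ideal (RCA b) where
  carrier := filSpan b n
  add_mem' := (filSpan b n).add_mem
  zero_mem' := (filSpan b n).zero_mem
  smul_mem' a a' h := by
    have := mul_mem_filSpan b (mem_filSpan_zero b a) h
    rwa [Nat.zero_add] at this

instance (b : P.Base) (n : ℕ) : (fil b n).IsTwoSided where
  mul_mem_of_left a' h := by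
    have := mul_mem_filSpan b h (mem_filSpan_zero b a')
    rwa [Nat.add_zero] at this

theorem fil_anti (b : P.Base) {m n : ℕ} (h : m ≤ n) : fil b n ≤ fil b m :=
  filSpan_anti b h

/-- The completion of the rational Cherednik algebra with respect to its grading: compatible
families of elements of the quotients by the ideals of elements of degree at least `n`. -/
def completion (b : P.Base) : Subalgebra ℂ (∀ n, RCA b ⧸ fil b n) where
  carrier := {f | ∀ m n (h : m ≤ n), Ideal.Quotient.factorₐ ℂ (fil_anti b h) (f n) = f m}
  mul_mem' hf hg m n h := by simp only [Pi.mul_apply, map_mul, hf m n h, hg m n h]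
  add_mem' hf hg m n h := by simp only [Pi.add_apply, map_add, hf m n h, hg m n h]
  algebraMap_mem' r m n h := by simp only [Pi.algebraMap_apply, AlgHom.commutes]

/-- The canonical map from the rational Cherednik algebra to its completion. -/
def toCompletion (b : P.Base) : RCA b →ₐ[ℂ] completion b :=
  (AlgHom.pi fun n => Ideal.Quotient.mkₐ ℂ (fil b n)).codRestrict _ fun _ _ _ _ => rfl

/-- The sum `∑ a_n` in the completion of a series with `a_n` of degree at least `n`. -/
def series (b : P.Base) (a : ℕ → RCA b) (ha : ∀ n, a n ∈ fil b n) : completion b :=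
  ⟨fun n => Ideal.Quotient.mkₐ ℂ (fil b n) (∑ i ∈ Finset.range n, a i), fun m n h => by
    change Ideal.Quotient.mk (fil b m) (∑ i ∈ Finset.range n, a i) =
      Ideal.Quotient.mk (fil b m) (∑ i ∈ Finset.range m, a i)
    rw [Ideal.Quotient.eq, ← Finset.sum_range_add_sum_Ico a h, add_sub_cancel_left]
    exact Ideal.sum_mem _ fun i hi => fil_anti b (Finset.mem_Ico.mp hi).1 (ha i)⟩

/-- The commutator with `ξ ∈ 𝔥*`. -/
def adx (b : P.Base) (ξ : M) (t : RCA b) : RCA b := x b ξ * t - t * x b ξ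

theorem adx_iterate_mem (b : P.Base) (ξ : M) (t : RCA b) (n : ℕ) :
    (adx b ξ)^[n] t ∈ fil b n := by
  have hx : x b ξ ∈ filSpan b 1 := gen_mem_filSpan b (.x ξ)
  induction n with
  | zero => exact mem_filSpan_zero b t
  | succ n ih =>
    rw [Function.iterate_succ_apply']
    refine Ideal.sub_mem _ ?_ (mul_mem_filSpan b ih hx)
    have := mul_mem_filSpan b hx ih
    rwa [Nat.add_comm] at this

theorem x_pow_mem (b : P.Base) (ξ : M) (n : ℕ) : x b ξ ^ n ∈ fil b n := by
  have hx : x b ξ ∈ filSpan b 1 := gen_mem_filSpan b (.x ξ)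
  induction n with
  | zero => exact mem_filSpan_zero b _
  | succ n ih => rw [pow_succ]; exact mul_mem_filSpan b ih hx

/-- The value `p(ξ)` of a power series `p` at an element `ξ ∈ 𝔥*`. -/
def evalx (b : P.Base) (p : PowerSeries ℂ) (ξ : M) : completion b :=
  series b (fun n => PowerSeries.coeff n p • x b ξ ^ n)
    fun n => (filSpan b n).smul_mem _ (x_pow_mem b ξ n)

/-- The value `p(ad ξ)(t)` of a power series `p` at the operator `ad ξ`, `ξ ∈ 𝔥*`, applied
to `t`. -/
def evalad (b : P.Base) (p : PowerSeries ℂ) (ξ : M) (t : RCA b) : completion b :=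
  series b (fun n => PowerSeries.coeff n p • (adx b ξ)^[n] t)
    fun n => (filSpan b n).smul_mem _ (adx_iterate_mem b ξ t n)

end RCA

/-! ### The connections -/

/-- The coefficient at the point `z` and the tangent vector `u` of the affine KZ connection
`d - ∑_{α > 0} 2πi dα / (e^{2πi α} - 1) k_α s_α - 2πi ∑_j x(u^j) du_j`. -/
def akzCoeff (b : P.Base) (z u : N) : DAHA b :=
  ∑ i ∈ posRoots b, (twoPiI * P.root' i u / (Complex.exp (twoPiI * P.root' i z) - 1)) •
    (DAHA.k b i * DAHA.w b (refl P i)) + twoPiI • DAHA.x b u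

/-- The element `t_α = ħ / h^∨ - 2 c_α / (α|α) s_α`. -/
def tElt [FiniteDimensional ℂ N] (b : P.Base) (B : LinearMap.BilinForm ℂ N)
    (hB : B.Nondegenerate) (θ i : ι) : RCA b :=
  (dualCoxeter b θ)⁻¹ • RCA.hbar b -
    (2 / rootNormSq P B hB i) • (RCA.c b i * RCA.w b (refl P i))

/-- The coefficient at the point `z` and the tangent vector `u` of the elliptic KZ connection
`d - ∑_{α > 0} k(α, ad(x_{α^∨} / 2) | τ)(t_α) dα + ∑_j y(u^j) du_j` with values in the completed
rational Cherednik algebra. -/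
def ellCoeff [FiniteDimensional ℂ N] (b : P.Base) (B : LinearMap.BilinForm ℂ N)
    (hB : B.Nondegenerate) (θ : ι) (τ : ℍ) (z u : N) : RCA.completion b :=
  ∑ i ∈ posRoots b, P.root' i u • RCA.evalad b (kSeries (P.root' i z) τ)
      ((1 / 2 : ℂ) • formIso P B hB (P.coroot i)) (tElt b B hB θ i) -
    RCA.toCompletion b (RCA.y b u)

end

end AffineKZ

end

set_option linter.unusedSectionVars false

noncomputable section

open Filter Topology

namespace AffineKZ

/-! ### The trigonometric power series -/

/-! The elements `-2πi φ(x(u))` are D(u) = y(u) + ∑_{α > 0} α(u) c'_α f(x_{α^∨}) s_α, where c'_α =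
2c_α/(α|α) and f is `trigSeries`. Existence of φ means that they commute and satisfy the cross
relation with simple reflections. Write f = F + πi with F odd (`oddTrig`). Then D(u) = y(u) + 1/2 ∑
over all roots of α(u) c'_α Z_α s_α, with Z_α = F(x_{α^∨}) + πi sgn(α). A simple reflection s_i
moves the terms around but leaves the signs behind; only sgn(±α_i) is affected, and this gives the
cross relation (`wSer_mul_dunkl`).

For commutativity, [y, F(x)] is an ħ-derivative plus divided differences times reflections. In
[D(u), D(v)] everything weighted by α(u)α(v) cancels by symmetry, and what is left is a quarter of
the sum over pairs of (α ∧ β)(u, v) c'_α c'_β G_{αβ} s_α s_β (`commutator_formula`). The permutation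
(α, β) ↦ (β, -s_β α) preserves α ∧ β, c'_α c'_β and s_α s_β, so it suffices that G sums to zero
along its orbits when α and β are not proportional. Put X_α = 1/x_{α^∨}, H_α = F(x_{α^∨}) +
1/x_{α^∨} and S_α = πi sgn(α). In a field of fractions G_{αβ} is S S + X X - H H up to a coboundary
and a shift along the orbit. Each of the three functions ψ is odd, and ψ_1ψ_2 + ψ_2ψ_3 + ψ_3ψ_1 is a
constant whenever three coroots sum to zero: it is -(πi)² for S and H, by the sign rule and the
cotangent addition formula, and 0 for X. The rank two analysis `cyc_iterate_of_ne` shows that the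
orbit sum of ψψ is the same integer multiple of this constant for all three, so the total vanishes
(`sum_commSeries_eq_zero`).

This vanishing is proved over the domain S𝔥* and carried by a homomorphism into the Cherednik
algebra, so no basis theorem for the latter is needed. Completions are handled by an extra grading
variable: identities are proved between power series over H and then specialized at 1 (`RCA.atOne`).

For the degeneration, θ(z|τ) tends to sin(πz)/π locally uniformly, so the Taylor coefficients of
k(z, ·|τ) tend to those of π cot(πz) + π cot(πX) - 1/X (`divX_sin_quotient`). Since s_α x_{α^∨} =
-x_{α^∨} s_α, the operator ad(x_{α^∨}/2) acts on the powers x_{α^∨}^n s_α as left multiplication by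
x_{α^∨}. The limit therefore has the shape of φ applied to the affine coefficient plus a multiple of
ħ (`limit_eq`). -/

theorem X_mul_divX (f : PowerSeries ℂ) :
    PowerSeries.X * divX f = f - PowerSeries.C (PowerSeries.constantCoeff f) := by
  ext n
  cases n with
  | zero => simp
  | succ n => simp [divX, PowerSeries.coeff_succ_X_mul]

theorem twoPiI_ne_zero : twoPiI ≠ 0 := by
  simp [twoPiI, Real.pi_ne_zero]

theorem constantCoeff_divX (f : PowerSeries ℂ) :
    PowerSeries.constantCoeff (divX f) = PowerSeries.coeff 1 f := by
  rw [← PowerSeries.coeff_zero_eq_constantCoeff_apply, divX, PowerSeries.coeff_mk]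

theorem constantCoeff_expSeries : PowerSeries.constantCoeff expSeries = 1 := by
  rw [← PowerSeries.coeff_zero_eq_constantCoeff_apply, expSeries, PowerSeries.coeff_rescale]
  simp

theorem constantCoeff_divX_exp_sub_one :
    PowerSeries.constantCoeff (divX (expSeries - 1)) = twoPiI := by
  rw [constantCoeff_divX, expSeries, map_sub, PowerSeries.coeff_rescale, PowerSeries.coeff_exp,
    PowerSeries.coeff_one]
  simp

theorem X_mul_trigSeries :
    PowerSeries.X * trigSeries + 1 =
      PowerSeries.C twoPiI * expSeries * (divX (expSeries - 1))⁻¹ := by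
  rw [trigSeries, X_mul_divX]
  have h : PowerSeries.constantCoeff
      (PowerSeries.C twoPiI * expSeries * (divX (expSeries - 1))⁻¹ - 1) = 0 := by
    rw [map_sub, map_mul, map_mul, PowerSeries.constantCoeff_inv, constantCoeff_divX_exp_sub_one]
    simp [constantCoeff_expSeries, twoPiI_ne_zero]
  rw [h]
  simp

/-- The equation that characterizes `trigSeries`, with all inverses cleared, so that it can be
transported along ring homomorphisms such as `evalAt`. -/
theorem X_mul_trigSeries_mul :
    (PowerSeries.X * trigSeries + 1) * (expSeries - 1) =
      PowerSeries.C twoPiI * expSeries * PowerSeries.X := by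
  have h : expSeries - 1 = PowerSeries.X * divX (expSeries - 1) := by
    rw [X_mul_divX]; simp [constantCoeff_expSeries]
  have h' : (divX (expSeries - 1))⁻¹ * divX (expSeries - 1) = 1 :=
    PowerSeries.inv_mul_cancel _ (by rw [constantCoeff_divX_exp_sub_one]; exact twoPiI_ne_zero)
  rw [X_mul_trigSeries]
  conv_lhs => rw [h, ← h]
  linear_combination (PowerSeries.C twoPiI * expSeries * (divX (expSeries - 1))⁻¹) * h +
    (PowerSeries.C twoPiI * expSeries * PowerSeries.X) * h'

/-- The odd power series `πi (e^{2πi X} + 1) / (e^{2πi X} - 1) - 1 / X`. -/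
def oddTrig : PowerSeries ℂ := trigSeries - PowerSeries.C (twoPiI / 2)

theorem trigSeries_eq : trigSeries = oddTrig + PowerSeries.C (twoPiI / 2) := by
  simp [oddTrig]

section evalAt

variable {A : Type*} [CommRing A] [Algebra ℂ A]

/-- The power series `p(a X)` with coefficients in a commutative algebra. -/
def evalAt (a : A) : PowerSeries ℂ →+* PowerSeries A :=
  (PowerSeries.rescale a).comp (PowerSeries.map (algebraMap ℂ A))

theorem coeff_evalAt (a : A) (p : PowerSeries ℂ) (n : ℕ) :
    PowerSeries.coeff n (evalAt a p) = PowerSeries.coeff n p • a ^ n := by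
  simp [evalAt, PowerSeries.coeff_rescale, Algebra.smul_def, mul_comm]

theorem evalAt_X (a : A) : evalAt a PowerSeries.X = PowerSeries.C a * PowerSeries.X := by
  simp [evalAt, PowerSeries.rescale_X]

theorem evalAt_C (a : A) (r : ℂ) :
    evalAt a (PowerSeries.C r) = PowerSeries.C (algebraMap ℂ A r) := by
  ext n
  rw [coeff_evalAt, PowerSeries.coeff_C, PowerSeries.coeff_C]
  split_ifs with h
  · simp [h, Algebra.smul_def]
  · simp

theorem evalAt_expSeries_add (a b : A) :
    evalAt (a + b) expSeries = evalAt a expSeries * evalAt b expSeries := by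
  -- The exponential series over `A` requires a ℚ-algebra structure; it is taken through ℂ.
  let _ : Algebra ℚ A := Algebra.compHom A (algebraMap ℚ ℂ)
  have : IsScalarTower ℚ ℂ A := IsScalarTower.of_algebraMap_eq fun _ => rfl
  have h (a : A) : evalAt a expSeries =
      PowerSeries.rescale (a * algebraMap ℂ A twoPiI) (PowerSeries.exp A) := by
    ext n
    rw [coeff_evalAt, expSeries, PowerSeries.coeff_rescale, PowerSeries.coeff_rescale,
      PowerSeries.coeff_exp, PowerSeries.coeff_exp, Algebra.smul_def, mul_pow, map_mul, map_pow,
      ← IsScalarTower.algebraMap_apply]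
    ring
  rw [h, h, h, PowerSeries.exp_mul_exp_eq_exp_add, add_mul]

theorem evalAt_expSeries_zero : evalAt (0 : A) expSeries = 1 := by
  ext n
  rw [coeff_evalAt, PowerSeries.coeff_one]
  split_ifs with h
  · simp [h, expSeries]
  · simp [h]

theorem evalAt_expSeries_ne_one [NoZeroDivisors A] {a : A} (ha : a ≠ 0) :
    evalAt a expSeries - 1 ≠ 0 := by
  intro h
  have h1 := congrArg (PowerSeries.coeff 1) h
  rw [map_sub, coeff_evalAt, PowerSeries.coeff_one, expSeries, PowerSeries.coeff_rescale,
    PowerSeries.coeff_exp] at h1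
  have : FaithfulSMul ℂ A := by
    have : Nontrivial A := ⟨a, 0, ha⟩
    infer_instance
  simp [Algebra.smul_def, twoPiI_ne_zero, ha] at h1

theorem evalAt_trig_mul (a : A) :
    (PowerSeries.C a * PowerSeries.X * evalAt a trigSeries + 1) * (evalAt a expSeries - 1) =
      PowerSeries.C (algebraMap ℂ A twoPiI) * evalAt a expSeries *
        (PowerSeries.C a * PowerSeries.X) := by
  have := congrArg (evalAt a) X_mul_trigSeries_mul
  simpa only [map_mul, map_add, map_sub, map_one, evalAt_X, evalAt_C] using this

variable {K : Type*} [Field K] [Algebra (PowerSeries A) K]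
  [FaithfulSMul (PowerSeries A) K]

/-- The linear form `a X` in a field of fractions. -/
def linK (K : Type*) [Field K] [Algebra (PowerSeries A) K] (a : A) : K :=
  algebraMap (PowerSeries A) K (PowerSeries.C a * PowerSeries.X)

/-- The constant `πi`. -/
def piK (A K : Type*) [CommRing A] [Algebra ℂ A] [Field K] [Algebra (PowerSeries A) K] : K :=
  algebraMap (PowerSeries A) K (PowerSeries.C (algebraMap ℂ A (twoPiI / 2)))

/-- The function `πi (e^{2πi a X} + 1) / (e^{2πi a X} - 1)`. -/
def cothK (K : Type*) [Field K] [Algebra (PowerSeries A) K] (a : A) : K :=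
  algebraMap (PowerSeries A) K (evalAt a oddTrig) + (linK K a)⁻¹

theorem linK_add (a b : A) : linK K (a + b) = linK K a + linK K b := by
  simp [linK, add_mul]

theorem linK_ne_zero {a : A} (ha : a ≠ 0) : linK K a ≠ 0 := by
  rw [linK, Ne, FaithfulSMul.algebraMap_eq_zero_iff]
  intro h
  have := congrArg (PowerSeries.coeff 1) h
  simp [ha] at this

theorem cothK_mul [NoZeroDivisors A] {a : A} (ha : a ≠ 0) :
    cothK K a * (algebraMap _ K (evalAt a expSeries) - 1) =
      piK A K * (algebraMap _ K (evalAt a expSeries) + 1) := by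
  have h := congrArg (algebraMap (PowerSeries A) K) (evalAt_trig_mul a)
  have hl := linK_ne_zero (K := K) ha
  have h2 : (algebraMap (PowerSeries A) K) (PowerSeries.C (algebraMap ℂ A twoPiI)) =
      2 * piK A K := by
    rw [piK, ← map_ofNat (algebraMap (PowerSeries A) K) 2, ← map_mul,
      ← map_ofNat (PowerSeries.C (R := A)) 2, ← map_mul, ← map_ofNat (algebraMap ℂ A) 2, ← map_mul,
      mul_div_cancel₀ _ two_ne_zero]
  rw [trigSeries_eq, map_add (evalAt a), evalAt_C, map_mul, map_add, map_mul, ← linK, map_add,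
    ← piK, map_mul, map_mul, h2, ← linK, map_sub, map_one] at h
  rw [cothK]
  field_simp
  linear_combination h

/-- The addition formula of the cotangent. With E_a = e^{2πi aX} each factor is πi (E_a + 1)/(E_a -
1), and after clearing denominators the identity is a multiple of E_a E_b E_c = 1. -/
theorem cothK_relation [NoZeroDivisors A] {a b c : A} (ha : a ≠ 0) (hb : b ≠ 0) (hc : c ≠ 0)
    (h : a + b + c = 0) :
    cothK K a * cothK K b + cothK K b * cothK K c + cothK K c * cothK K a = -piK A K ^ 2 := by
  have hE {a : A} (ha : a ≠ 0) : algebraMap _ K (evalAt a expSeries) - 1 ≠ 0 := by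
    rw [← map_one (algebraMap (PowerSeries A) K), ← map_sub, Ne,
      FaithfulSMul.algebraMap_eq_zero_iff]
    exact evalAt_expSeries_ne_one ha
  have hm : algebraMap _ K (evalAt a expSeries) * algebraMap _ K (evalAt b expSeries) *
      algebraMap _ K (evalAt c expSeries) = 1 := by
    rw [← map_mul, ← map_mul, ← evalAt_expSeries_add, ← evalAt_expSeries_add, h,
      evalAt_expSeries_zero, map_one]
  have ea := eq_div_of_mul_eq (hE ha) (cothK_mul (K := K) ha)
  have eb := eq_div_of_mul_eq (hE hb) (cothK_mul (K := K) hb)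
  have ec := eq_div_of_mul_eq (hE hc) (cothK_mul (K := K) hc)
  have := hE ha
  have := hE hb
  have := hE hc
  rw [ea, eb, ec]
  field_simp
  linear_combination (4 : K) * piK A K ^ 2 * hm

theorem cothK_neg [NoZeroDivisors A] {a : A} (ha : a ≠ 0) : cothK K (-a) = -cothK K a := by
  have hE {a : A} (ha : a ≠ 0) : algebraMap _ K (evalAt a expSeries) - 1 ≠ 0 := by
    rw [← map_one (algebraMap (PowerSeries A) K), ← map_sub, Ne,
      FaithfulSMul.algebraMap_eq_zero_iff]
    exact evalAt_expSeries_ne_one ha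
  have hm : algebraMap _ K (evalAt a expSeries) * algebraMap _ K (evalAt (-a) expSeries) = 1 := by
    rw [← map_mul, ← evalAt_expSeries_add, add_neg_cancel, evalAt_expSeries_zero, map_one]
  have hn : -a ≠ 0 := neg_ne_zero.mpr ha
  rw [eq_div_of_mul_eq (hE ha) (cothK_mul (K := K) ha),
    eq_div_of_mul_eq (hE hn) (cothK_mul (K := K) hn)]
  have := hE ha
  have := hE hn
  field_simp
  linear_combination 2 * piK A K * hm

theorem linK_neg (a : A) : linK K (-a) = -linK K a := by simp [linK]

theorem evalAt_oddTrig_neg_of_field {A : Type*} [CommRing A] [Algebra ℂ A] [NoZeroDivisors A]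
    (K : Type*) [Field K] [Algebra (PowerSeries A) K] [FaithfulSMul (PowerSeries A) K]
    {a : A} (ha : a ≠ 0) : evalAt (-a) oddTrig = -evalAt a oddTrig := by
  have h := cothK_neg (K := K) ha
  rw [cothK, cothK, linK_neg, inv_neg, neg_add, add_left_inj, ← map_neg] at h
  exact FaithfulSMul.algebraMap_injective (PowerSeries A) K h

end evalAt

/-- Oddness of the hyperbolic cotangent, read off on coefficients at `A = ℂ` and `a = 1`. -/
theorem coeff_oddTrig (n : ℕ) :
    (-1) ^ n * PowerSeries.coeff n oddTrig = -PowerSeries.coeff n oddTrig := by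
  have h := congrArg (PowerSeries.coeff n)
    (evalAt_oddTrig_neg_of_field (FractionRing (PowerSeries ℂ)) (one_ne_zero (α := ℂ)))
  rw [map_neg, coeff_evalAt, coeff_evalAt] at h
  simpa [mul_comm] using h

theorem coeff_zero_oddTrig : PowerSeries.coeff 0 oddTrig = 0 := by
  have := coeff_oddTrig 0
  simpa [eq_neg_iff_add_eq_zero, ← two_mul] using this

/-! ### Rank two -/

section RankTwo

variable {ι M N : Type*} [Fintype ι] [AddCommGroup M] [Module ℂ M] [AddCommGroup N] [Module ℂ N]

theorem root_reflectionPerm_self (P : RootPairing ι ℂ M N) (i : ι) :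
    P.root (P.reflectionPerm i i) = -P.root i := by
  rw [P.root_reflectionPerm, P.reflection_apply_self]

theorem coroot_reflectionPerm_self (P : RootPairing ι ℂ M N) (i : ι) :
    P.coroot (P.reflectionPerm i i) = -P.coroot i := by
  rw [P.coroot_reflectionPerm, P.coreflection_apply_self]

/-- The permutation `(α, β) ↦ (β, -s_β α)` of pairs of roots. It preserves `s_α s_β`. -/
def cyc (P : RootPairing ι ℂ M N) : Equiv.Perm (ι × ι) where
  toFun p := (p.2, P.reflectionPerm p.2 (P.reflectionPerm p.1 p.1))
  invFun p := (P.reflectionPerm (P.reflectionPerm p.1 p.2) (P.reflectionPerm p.1 p.2), p.1)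
  left_inv p := by
    refine Prod.ext (P.root.injective ?_) rfl
    simp only [P.reflectionPerm_self, root_reflectionPerm_self, neg_neg]
  right_inv p := by
    refine Prod.ext rfl (P.root.injective ?_)
    rw [P.root_reflectionPerm, root_reflectionPerm_self, root_reflectionPerm_self, neg_neg,
      P.root_reflectionPerm, P.reflection_same]

theorem cyc_apply (P : RootPairing ι ℂ M N) (p : ι × ι) :
    cyc P p = (p.2, P.reflectionPerm p.2 (P.reflectionPerm p.1 p.1)) := rfl

/-- The coordinates of the coroots of a pair of roots and their mutual Cartan integers. -/
abbrev CycState := (ℤ × ℤ) × (ℤ × ℤ) × ℤ × ℤ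

/-- The action of `cyc` on coordinates. -/
def cycStep (s : CycState) : CycState :=
  (s.2.1, (s.2.2.1 * s.2.1.1 - s.1.1, s.2.2.1 * s.2.1.2 - s.1.2), s.2.2.2, s.2.2.1)

/-- Coordinates after `j` applications of `cyc`, with Cartan integers `p` and `q` at the start. -/
def cycState (p q : ℤ) (j : ℕ) : CycState := cycStep^[j] ((1, 0), (0, 1), p, q)

variable (P : RootPairing ι ℂ M N) (a b : ι)

/-- The coroot of -s_β α is ⟨β, α^∨⟩ β^∨ - α^∨, and one step of `cyc` interchanges the two Cartan
integers. The orbit of a pair is thus governed by integers alone, and coincidences in it can be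
checked by `decide`. -/
theorem cyc_iterate_coroot {p q : ℤ} (hp : P.pairing b a = p) (hq : P.pairing a b = q) (j : ℕ) :
    P.coroot ((cyc P)^[j] (a, b)).1 =
      (cycState p q j).1.1 • P.coroot a + (cycState p q j).1.2 • P.coroot b ∧
    P.coroot ((cyc P)^[j] (a, b)).2 =
      (cycState p q j).2.1.1 • P.coroot a + (cycState p q j).2.1.2 • P.coroot b ∧
    P.pairing ((cyc P)^[j] (a, b)).2 ((cyc P)^[j] (a, b)).1 = (cycState p q j).2.2.1 ∧
    P.pairing ((cyc P)^[j] (a, b)).1 ((cyc P)^[j] (a, b)).2 = (cycState p q j).2.2.2 := by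
  induction j with
  | zero => simp [cycState, hp, hq]
  | succ j ih =>
    obtain ⟨h1, h2, h3, h4⟩ := ih
    rw [cycState] at h1 h2 h3 h4
    rw [cycState, Function.iterate_succ_apply', Function.iterate_succ_apply']
    set s := cycStep^[j] ((1, 0), (0, 1), p, q)
    set c := (cyc P)^[j] (a, b)
    rw [cyc_apply]
    refine ⟨h2, ?_, ?_, ?_⟩
    · rw [P.coroot_reflectionPerm, P.coroot_reflectionPerm, P.coreflection_apply_self, map_neg,
        P.coreflection_apply_coroot, h3, h1, h2, cycStep]
      simp only [Int.cast_smul_eq_zsmul]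
      module
    · change P.pairing (P.reflectionPerm c.2 (P.reflectionPerm c.1 c.1)) c.2 = _
      rw [← P.pairing_reflectionPerm, P.pairing_reflectionPerm_self_right,
        P.pairing_reflectionPerm_self_left, neg_neg, h4]
      rfl
    · change P.pairing c.2 (P.reflectionPerm c.2 (P.reflectionPerm c.1 c.1)) = _
      rw [P.pairing_reflectionPerm, P.pairing_reflectionPerm_self_left,
        P.pairing_reflectionPerm_self_right, neg_neg, h3]
      rfl

variable [P.IsCrystallographic] [P.IsReduced]

/-- In rank two the coordinate sequences have periods 3, 4, 6, 8 or 12, all dividing 24. What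
matters is that `n` depends only on the pair of roots and not on ψ: the same integer then serves for
three different functions. Only oddness and the relation for zero-sum triples of coroots enter. -/
theorem cyc_iterate_of_ne (h1 : P.root b ≠ P.root a) (h2 : P.root b ≠ -P.root a) :
    (cyc P)^[24] (a, b) = (a, b) ∧ ∃ n : ℤ, ∀ (K : Type*) [CommRing K] (ψ : ι → K) (c : K),
      (∀ i, ψ (P.reflectionPerm i i) = -ψ i) →
      (∀ i j k, P.coroot i + P.coroot j + P.coroot k = 0 →
        ψ i * ψ j + ψ j * ψ k + ψ k * ψ i = c) →
      ∑ j ∈ Finset.range 24, ψ ((cyc P)^[j] (a, b)).1 * ψ ((cyc P)^[j] (a, b)).2 = n * c := by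
  obtain ⟨p, hp⟩ : ∃ p : ℤ, p = P.pairingIn ℤ b a := ⟨_, rfl⟩
  obtain ⟨q, hq⟩ : ∃ q : ℤ, q = P.pairingIn ℤ a b := ⟨_, rfl⟩
  have hpq := P.pairingIn_pairingIn_mem_set_of_isCrystal_of_isRed' b a h1 h2
  have hp' : P.pairing b a = p := by rw [hp, ← P.algebraMap_pairingIn ℤ]; rfl
  have hq' : P.pairing a b = q := by rw [hq, ← P.algebraMap_pairingIn ℤ]; rfl
  rw [← hp, ← hq] at hpq
  have hc j := (cyc_iterate_coroot P a b hp' hq' j).1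
  -- The orbit is a sequence of roots of which each pair shows two neighbours, so first components
  -- suffice.
  have hs j : ((cyc P)^[j] (a, b)).2 = ((cyc P)^[j + 1] (a, b)).1 := by
    rw [Function.iterate_succ_apply']; rfl
  have he (i j : ℕ) (h : (cycState p q i).1 = (cycState p q j).1) :
      ((cyc P)^[i] (a, b)).1 = ((cyc P)^[j] (a, b)).1 :=
    P.coroot.injective (by rw [hc, hc, h])
  have hn (i j : ℕ) (h : (cycState p q i).1 = -(cycState p q j).1) :
      ((cyc P)^[i] (a, b)).1 =
        P.reflectionPerm ((cyc P)^[j] (a, b)).1 ((cyc P)^[j] (a, b)).1 := by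
    refine P.coroot.injective ?_
    rw [P.coroot_reflectionPerm, P.coreflection_apply_self, hc, hc, h, Prod.fst_neg, Prod.snd_neg]
    module
  have hr (i j k : ℕ) (h : (cycState p q i).1 + (cycState p q j).1 + (cycState p q k).1 = 0) :
      P.coroot ((cyc P)^[i] (a, b)).1 + P.coroot ((cyc P)^[j] (a, b)).1 +
        P.coroot ((cyc P)^[k] (a, b)).1 = 0 := by
    have h1 := congrArg Prod.fst h
    have h2 := congrArg Prod.snd h
    simp only [Prod.fst_add, Prod.snd_add, Prod.fst_zero, Prod.snd_zero] at h1 h2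
    have : ∀ (x y x' y' x'' y'' : ℤ) (v w : N), x + x' + x'' = 0 → y + y' + y'' = 0 →
        x • v + y • w + (x' • v + y' • w) + (x'' • v + y'' • w) = 0 := by
      intro x y x' y' x'' y'' v w h h'
      rw [show x • v + y • w + (x' • v + y' • w) + (x'' • v + y'' • w) =
        (x + x' + x'') • v + (y + y' + y'') • w by module, h, h', zero_smul, zero_smul, add_zero]
    rw [hc, hc, hc]
    exact this _ _ _ _ _ _ _ _ h1 h2
  have hper (h0 : (cycState p q 24).1 = (cycState p q 0).1)
      (h1 : (cycState p q 25).1 = (cycState p q 1).1) : (cyc P)^[24] (a, b) = (a, b) :=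
    Prod.ext (he 24 0 h0) (by rw [hs, he 25 1 h1]; rfl)
  simp only [hs]
  simp only [Set.mem_insert_iff, Set.mem_singleton_iff, Prod.mk.injEq] at hpq
  -- The possible Cartan integers: orthogonal roots, then types A2, B2 and G2 with either sign and
  -- order. The facts `he` and `hn` reduce all entries to an initial segment up to sign. For
  -- orthogonal roots the products cancel in pairs; otherwise the relations `r0`, `r1`, ... come
  -- from zero-sum triples chosen so that their sum expresses the sum of products of neighbours.
  rcases hpq with ⟨rfl, rfl⟩ | ⟨rfl, rfl⟩ | ⟨rfl, rfl⟩ | ⟨rfl, rfl⟩ | ⟨rfl, rfl⟩ | ⟨rfl, rfl⟩ |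
    ⟨rfl, rfl⟩ | ⟨rfl, rfl⟩ | ⟨rfl, rfl⟩ | ⟨rfl, rfl⟩ | ⟨rfl, rfl⟩
  · refine ⟨hper (by decide) (by decide), 0, fun K _ ψ c hodd hrel => ?_⟩
    simp only [Finset.sum_range_succ, Finset.sum_range_zero, Nat.reduceAdd, hodd, he 24 0 (by decide),
      hn 2 0 (by decide), hn 3 1 (by decide), he 4 0 (by decide), he 5 1 (by decide),
      hn 6 0 (by decide), hn 7 1 (by decide), he 8 0 (by decide), he 9 1 (by decide),
      hn 10 0 (by decide), hn 11 1 (by decide), he 12 0 (by decide), he 13 1 (by decide),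
      hn 14 0 (by decide), hn 15 1 (by decide), he 16 0 (by decide), he 17 1 (by decide),
      hn 18 0 (by decide), hn 19 1 (by decide), he 20 0 (by decide), he 21 1 (by decide),
      hn 22 0 (by decide), hn 23 1 (by decide)]
    push_cast
    ring
  · refine ⟨hper (by decide) (by decide), -8, fun K _ ψ c hodd hrel => ?_⟩
    have r0 := hrel _ _ _ (hr 0 2 4 (by decide))
    simp only [hodd, hn 4 1 (by decide)] at r0
    simp only [Finset.sum_range_succ, Finset.sum_range_zero, Nat.reduceAdd, hodd, he 24 0 (by decide),
      hn 3 0 (by decide), hn 4 1 (by decide), hn 5 2 (by decide), he 6 0 (by decide),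
      he 7 1 (by decide), he 8 2 (by decide), hn 9 0 (by decide), hn 10 1 (by decide),
      hn 11 2 (by decide), he 12 0 (by decide), he 13 1 (by decide), he 14 2 (by decide),
      hn 15 0 (by decide), hn 16 1 (by decide), hn 17 2 (by decide), he 18 0 (by decide),
      he 19 1 (by decide), he 20 2 (by decide), hn 21 0 (by decide), hn 22 1 (by decide),
      hn 23 2 (by decide)]
    push_cast
    linear_combination -8 * r0
  · refine ⟨hper (by decide) (by decide), 8, fun K _ ψ c hodd hrel => ?_⟩
    have r0 := hrel _ _ _ (hr 0 1 2 (by decide))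
    simp only [Finset.sum_range_succ, Finset.sum_range_zero, Nat.reduceAdd, he 24 0 (by decide),
      he 3 0 (by decide), he 4 1 (by decide), he 5 2 (by decide), he 6 0 (by decide),
      he 7 1 (by decide), he 8 2 (by decide), he 9 0 (by decide), he 10 1 (by decide),
      he 11 2 (by decide), he 12 0 (by decide), he 13 1 (by decide), he 14 2 (by decide),
      he 15 0 (by decide), he 16 1 (by decide), he 17 2 (by decide), he 18 0 (by decide),
      he 19 1 (by decide), he 20 2 (by decide), he 21 0 (by decide), he 22 1 (by decide),
      he 23 2 (by decide)]
    push_cast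
    linear_combination 8 * r0
  · refine ⟨hper (by decide) (by decide), -12, fun K _ ψ c hodd hrel => ?_⟩
    have r0 := hrel _ _ _ (hr 0 2 5 (by decide))
    have r1 := hrel _ _ _ (hr 0 3 6 (by decide))
    simp only [hodd, hn 5 1 (by decide), hn 6 2 (by decide)] at r0 r1
    simp only [Finset.sum_range_succ, Finset.sum_range_zero, Nat.reduceAdd, hodd, he 24 0 (by decide),
      hn 4 0 (by decide), hn 5 1 (by decide), hn 6 2 (by decide), hn 7 3 (by decide),
      he 8 0 (by decide), he 9 1 (by decide), he 10 2 (by decide), he 11 3 (by decide),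
      hn 12 0 (by decide), hn 13 1 (by decide), hn 14 2 (by decide), hn 15 3 (by decide),
      he 16 0 (by decide), he 17 1 (by decide), he 18 2 (by decide), he 19 3 (by decide),
      hn 20 0 (by decide), hn 21 1 (by decide), hn 22 2 (by decide), hn 23 3 (by decide)]
    push_cast
    linear_combination -6 * r0 - 6 * r1
  · refine ⟨hper (by decide) (by decide), -12, fun K _ ψ c hodd hrel => ?_⟩
    have r0 := hrel _ _ _ (hr 0 3 5 (by decide))
    have r1 := hrel _ _ _ (hr 1 3 6 (by decide))
    simp only [hodd, hn 5 1 (by decide), hn 6 2 (by decide)] at r0 r1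
    simp only [Finset.sum_range_succ, Finset.sum_range_zero, Nat.reduceAdd, hodd, he 24 0 (by decide),
      hn 4 0 (by decide), hn 5 1 (by decide), hn 6 2 (by decide), hn 7 3 (by decide),
      he 8 0 (by decide), he 9 1 (by decide), he 10 2 (by decide), he 11 3 (by decide),
      hn 12 0 (by decide), hn 13 1 (by decide), hn 14 2 (by decide), hn 15 3 (by decide),
      he 16 0 (by decide), he 17 1 (by decide), he 18 2 (by decide), he 19 3 (by decide),
      hn 20 0 (by decide), hn 21 1 (by decide), hn 22 2 (by decide), hn 23 3 (by decide)]
    push_cast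
    linear_combination -6 * r0 - 6 * r1
  · refine ⟨hper (by decide) (by decide), 12, fun K _ ψ c hodd hrel => ?_⟩
    have r0 := hrel _ _ _ (hr 0 1 2 (by decide))
    have r1 := hrel _ _ _ (hr 0 6 7 (by decide))
    simp only [hodd, hn 6 2 (by decide), hn 7 3 (by decide)] at r0 r1
    simp only [Finset.sum_range_succ, Finset.sum_range_zero, Nat.reduceAdd, hodd, he 24 0 (by decide),
      hn 4 0 (by decide), hn 5 1 (by decide), hn 6 2 (by decide), hn 7 3 (by decide),
      he 8 0 (by decide), he 9 1 (by decide), he 10 2 (by decide), he 11 3 (by decide),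
      hn 12 0 (by decide), hn 13 1 (by decide), hn 14 2 (by decide), hn 15 3 (by decide),
      he 16 0 (by decide), he 17 1 (by decide), he 18 2 (by decide), he 19 3 (by decide),
      hn 20 0 (by decide), hn 21 1 (by decide), hn 22 2 (by decide), hn 23 3 (by decide)]
    push_cast
    linear_combination 6 * r0 + 6 * r1
  · refine ⟨hper (by decide) (by decide), 12, fun K _ ψ c hodd hrel => ?_⟩
    have r0 := hrel _ _ _ (hr 0 1 7 (by decide))
    have r1 := hrel _ _ _ (hr 1 2 3 (by decide))
    simp only [hodd, hn 7 3 (by decide)] at r0 r1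
    simp only [Finset.sum_range_succ, Finset.sum_range_zero, Nat.reduceAdd, hodd, he 24 0 (by decide),
      hn 4 0 (by decide), hn 5 1 (by decide), hn 6 2 (by decide), hn 7 3 (by decide),
      he 8 0 (by decide), he 9 1 (by decide), he 10 2 (by decide), he 11 3 (by decide),
      hn 12 0 (by decide), hn 13 1 (by decide), hn 14 2 (by decide), hn 15 3 (by decide),
      he 16 0 (by decide), he 17 1 (by decide), he 18 2 (by decide), he 19 3 (by decide),
      hn 20 0 (by decide), hn 21 1 (by decide), hn 22 2 (by decide), hn 23 3 (by decide)]
    push_cast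
    linear_combination 6 * r0 + 6 * r1
  · refine ⟨hper (by decide) (by decide), -16, fun K _ ψ c hodd hrel => ?_⟩
    have r0 := hrel _ _ _ (hr 0 2 7 (by decide))
    have r1 := hrel _ _ _ (hr 0 4 8 (by decide))
    have r2 := hrel _ _ _ (hr 0 5 10 (by decide))
    have r3 := hrel _ _ _ (hr 2 4 9 (by decide))
    simp only [hodd, hn 7 1 (by decide), hn 8 2 (by decide), hn 9 3 (by decide),
      hn 10 4 (by decide)] at r0 r1 r2 r3
    simp only [Finset.sum_range_succ, Finset.sum_range_zero, Nat.reduceAdd, hodd, he 24 0 (by decide),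
      hn 6 0 (by decide), hn 7 1 (by decide), hn 8 2 (by decide), hn 9 3 (by decide),
      hn 10 4 (by decide), hn 11 5 (by decide), he 12 0 (by decide), he 13 1 (by decide),
      he 14 2 (by decide), he 15 3 (by decide), he 16 4 (by decide), he 17 5 (by decide),
      hn 18 0 (by decide), hn 19 1 (by decide), hn 20 2 (by decide), hn 21 3 (by decide),
      hn 22 4 (by decide), hn 23 5 (by decide)]
    push_cast
    linear_combination -4 * r0 - 4 * r1 - 4 * r2 - 4 * r3
  · refine ⟨hper (by decide) (by decide), -16, fun K _ ψ c hodd hrel => ?_⟩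
    have r0 := hrel _ _ _ (hr 0 5 7 (by decide))
    have r1 := hrel _ _ _ (hr 1 3 8 (by decide))
    have r2 := hrel _ _ _ (hr 1 5 9 (by decide))
    have r3 := hrel _ _ _ (hr 3 5 10 (by decide))
    simp only [hodd, hn 7 1 (by decide), hn 8 2 (by decide), hn 9 3 (by decide),
      hn 10 4 (by decide)] at r0 r1 r2 r3
    simp only [Finset.sum_range_succ, Finset.sum_range_zero, Nat.reduceAdd, hodd, he 24 0 (by decide),
      hn 6 0 (by decide), hn 7 1 (by decide), hn 8 2 (by decide), hn 9 3 (by decide),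
      hn 10 4 (by decide), hn 11 5 (by decide), he 12 0 (by decide), he 13 1 (by decide),
      he 14 2 (by decide), he 15 3 (by decide), he 16 4 (by decide), he 17 5 (by decide),
      hn 18 0 (by decide), hn 19 1 (by decide), hn 20 2 (by decide), hn 21 3 (by decide),
      hn 22 4 (by decide), hn 23 5 (by decide)]
    push_cast
    linear_combination -4 * r0 - 4 * r1 - 4 * r2 - 4 * r3
  · refine ⟨hper (by decide) (by decide), 16, fun K _ ψ c hodd hrel => ?_⟩
    have r0 := hrel _ _ _ (hr 0 1 2 (by decide))
    have r1 := hrel _ _ _ (hr 0 4 8 (by decide))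
    have r2 := hrel _ _ _ (hr 0 10 11 (by decide))
    have r3 := hrel _ _ _ (hr 2 3 4 (by decide))
    simp only [hodd, hn 8 2 (by decide), hn 10 4 (by decide), hn 11 5 (by decide)] at r0 r1 r2 r3
    simp only [Finset.sum_range_succ, Finset.sum_range_zero, Nat.reduceAdd, hodd, he 24 0 (by decide),
      hn 6 0 (by decide), hn 7 1 (by decide), hn 8 2 (by decide), hn 9 3 (by decide),
      hn 10 4 (by decide), hn 11 5 (by decide), he 12 0 (by decide), he 13 1 (by decide),
      he 14 2 (by decide), he 15 3 (by decide), he 16 4 (by decide), he 17 5 (by decide),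
      hn 18 0 (by decide), hn 19 1 (by decide), hn 20 2 (by decide), hn 21 3 (by decide),
      hn 22 4 (by decide), hn 23 5 (by decide)]
    push_cast
    linear_combination 4 * r0 + 4 * r1 + 4 * r2 + 4 * r3
  · refine ⟨hper (by decide) (by decide), 16, fun K _ ψ c hodd hrel => ?_⟩
    have r0 := hrel _ _ _ (hr 0 1 11 (by decide))
    have r1 := hrel _ _ _ (hr 1 2 3 (by decide))
    have r2 := hrel _ _ _ (hr 1 5 9 (by decide))
    have r3 := hrel _ _ _ (hr 3 4 5 (by decide))
    simp only [hodd, hn 9 3 (by decide), hn 11 5 (by decide)] at r0 r1 r2 r3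
    simp only [Finset.sum_range_succ, Finset.sum_range_zero, Nat.reduceAdd, hodd, he 24 0 (by decide),
      hn 6 0 (by decide), hn 7 1 (by decide), hn 8 2 (by decide), hn 9 3 (by decide),
      hn 10 4 (by decide), hn 11 5 (by decide), he 12 0 (by decide), he 13 1 (by decide),
      he 14 2 (by decide), he 15 3 (by decide), he 16 4 (by decide), he 17 5 (by decide),
      hn 18 0 (by decide), hn 19 1 (by decide), hn 20 2 (by decide), hn 21 3 (by decide),
      hn 22 4 (by decide), hn 23 5 (by decide)]
    push_cast
    linear_combination 4 * r0 + 4 * r1 + 4 * r2 + 4 * r3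

end RankTwo

/-! ### Signs of roots -/

section Sign

variable {ι M N : Type*} [Fintype ι] [AddCommGroup M] [Module ℂ M] [AddCommGroup N] [Module ℂ N]
  {P : RootPairing ι ℂ M N} [P.IsCrystallographic] [P.IsReduced]

open Classical in
/-- The sign of a root. -/
def rootSign (b : P.Base) (i : ι) : ℤ := if b.IsPos i then 1 else -1

theorem rootSign_neg (b : P.Base) (i : ι) :
    rootSign b (P.reflectionPerm i i) = -rootSign b i := by
  have := RootPairing.Base.IsPos.neg_iff_not b i
  rw [RootPairing.indexNeg_neg] at this
  unfold rootSign
  split_ifs <;> simp_all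

/-- A simple reflection permutes the positive roots other than its own; negative roots follow by
negation. -/
theorem rootSign_reflectionPerm (b : P.Base) {i j : ι} (hj : j ∈ b.support) (h1 : i ≠ j)
    (h2 : i ≠ P.reflectionPerm j j) : rootSign b (P.reflectionPerm j i) = rootSign b i := by
  have key {i : ι} (h1 : i ≠ j) (h : b.IsPos i) :
      rootSign b (P.reflectionPerm j i) = rootSign b i := by
    rw [rootSign, rootSign, if_pos h, if_pos (h.reflectionPerm hj h1)]
  by_cases h : b.IsPos i
  · exact key h1 h
  · have h' := (RootPairing.Base.IsPos.neg_iff_not b i).2 h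
    rw [RootPairing.indexNeg_neg] at h'
    have h3 : P.reflectionPerm i i ≠ j := by
      rintro rfl
      refine h2 (P.root.injective ?_)
      rw [root_reflectionPerm_self, root_reflectionPerm_self, neg_neg]
    have h4 : P.reflectionPerm j (P.reflectionPerm i i) =
        P.reflectionPerm (P.reflectionPerm j i) (P.reflectionPerm j i) := P.root.injective (by
      rw [P.root_reflectionPerm, root_reflectionPerm_self, root_reflectionPerm_self,
        P.root_reflectionPerm, map_neg])
    have h5 := key h3 h'
    rwa [h4, rootSign_neg, rootSign_neg, neg_inj] at h5

/-- Needed because the zero-sum triples are triples of coroots. The signs for a base and its dual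
agree on simple roots and behave alike under simple reflections and negation, which reach every
root. -/
theorem rootSign_flip (b : P.Base) (i : ι) : rootSign b.flip i = rootSign b i := by
  have hneg {i : ι} (h : rootSign b.flip i = rootSign b i) :
      rootSign b.flip (P.reflectionPerm i i) = rootSign b (P.reflectionPerm i i) := by
    rw [rootSign_neg b i, ← h]
    exact rootSign_neg b.flip i
  refine b.induction_reflect i (p := fun i => rootSign b.flip i = rootSign b i)
    (fun i h => hneg h) (fun i hi => ?_) fun i j h hj => ?_
  · rw [rootSign, rootSign, if_pos (RootPairing.Base.isPos_of_mem_support hi),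
      if_pos (RootPairing.Base.isPos_of_mem_support (b := b.flip) hi)]
  · by_cases h1 : i = j
    · subst h1; exact hneg h
    by_cases h2 : i = P.reflectionPerm j j
    · have h3 : P.reflectionPerm j i = P.reflectionPerm i i := P.root.injective (by
        rw [root_reflectionPerm_self, P.root_reflectionPerm, h2, root_reflectionPerm_self, map_neg,
          P.reflection_apply_self])
      rw [h3]; exact hneg h
    · rw [rootSign_reflectionPerm b hj h1 h2, ← h]
      exact rootSign_reflectionPerm b.flip hj h1 h2

/-- Heights of coroots are additive and nonzero. Three of them with sum zero cannot all have the
same sign, and for two equal signs and one opposite the expression is 1 - 1 - 1. -/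
theorem rootSign_relation (b : P.Base) {i j k : ι}
    (h : P.coroot i + P.coroot j + P.coroot k = 0) :
    rootSign b i * rootSign b j + rootSign b j * rootSign b k + rootSign b k * rootSign b i =
      -1 := by
  have h1 := RootPairing.Base.height_add b.flip (i := i) (j := j) (k := P.reflectionPerm k k) (by
    change P.coroot _ = P.coroot _ + P.coroot _
    rw [coroot_reflectionPerm_self]
    exact (eq_neg_of_add_eq_zero_left h).symm)
  have h2 := RootPairing.Base.height_reflectionPerm_self b.flip k
  rw [RootPairing.indexNeg_neg] at h2
  change RootPairing.Base.height b.flip (P.reflectionPerm k k) = _ at h2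
  have h3 := b.flip.height_ne_zero i
  have h4 := b.flip.height_ne_zero j
  have h5 := b.flip.height_ne_zero k
  rw [← rootSign_flip b i, ← rootSign_flip b j, ← rootSign_flip b k]
  simp only [rootSign, RootPairing.Base.isPos_iff]
  split_ifs <;> first | rfl | omega

end Sign

/-! ### Vanishing of the orbit sums over a commutative domain -/

section Upstairs

variable {ι M N : Type*} [Fintype ι] [AddCommGroup M] [Module ℂ M] [AddCommGroup N] [Module ℂ N]
  (P : RootPairing ι ℂ M N) [P.IsCrystallographic] [P.IsReduced]
  {A : Type*} [CommRing A] [Algebra ℂ A] (L : N →ₗ[ℂ] A) (b : P.Base)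

/-- The power series `F(L(α^∨)) ± πi`, where the sign is that of `α'` and `F` is the odd part
of `trigSeries`. -/
def signedTrig (i j : ι) : PowerSeries A :=
  evalAt (L (P.coroot i)) oddTrig +
    rootSign b j • PowerSeries.C (algebraMap ℂ A (twoPiI / 2))

/-- The divided difference `(F(L(β^∨)) - F(L(s_α β^∨))) / L(α^∨)`. -/
def divDiff (i j : ι) : PowerSeries A :=
  PowerSeries.mk fun n => (PowerSeries.coeff (n + 1) oddTrig * P.pairing i j) •
    ∑ k ∈ Finset.range (n + 1),
      L (P.coroot j) ^ k * L (P.coroot (P.reflectionPerm i j)) ^ (n - k)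

/-- A telescoping geometric sum, since β^∨ - s_α β^∨ is a multiple of α^∨. The factor X compensates
the shift of the coefficients in `divDiff`. -/
theorem mul_divDiff (i j : ι) :
    PowerSeries.C (L (P.coroot i)) * PowerSeries.X * divDiff P L i j =
      evalAt (L (P.coroot j)) oddTrig -
        evalAt (L (P.coroot (P.reflectionPerm i j))) oddTrig := by
  ext n
  rw [mul_assoc, PowerSeries.coeff_C_mul, map_sub, coeff_evalAt, coeff_evalAt]
  cases n with
  | zero => simp
  | succ n =>
    rw [PowerSeries.coeff_succ_X_mul, divDiff, PowerSeries.coeff_mk]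
    have h := Commute.geom_sum₂_mul (Commute.all (L (P.coroot j))
      (L (P.coroot (P.reflectionPerm i j)))) (n + 1)
    have h2 : L (P.coroot j) - L (P.coroot (P.reflectionPerm i j)) =
        P.pairing i j • L (P.coroot i) := by
      rw [P.coroot_reflectionPerm, P.coreflection_apply_coroot, map_sub, map_smul]
      abel
    rw [h2] at h
    rw [← smul_sub, ← h, Nat.add_sub_cancel]
    simp only [Algebra.smul_def, map_mul]
    ring

/-- The coefficient of `s_α s_β` in the commutator. -/
def commSeries (i j : ι) : PowerSeries A :=
  signedTrig P L b i i * signedTrig P L b (P.reflectionPerm i j) j - divDiff P L i j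

/-- In the field the divided differences become honest fractions. The summand is then s s + x x - h
h, with h h taken one step earlier on the orbit, plus g - g ∘ cyc for an explicit g. The coboundary
and the shift disappear over a closed orbit. The rest is m(-π'² + 0 + π'²) = 0, with π' the constant
`piK` and m the integer of `cyc_iterate_of_ne`. -/
theorem sum_commSeries_eq_zero_of_field [NoZeroDivisors A] (K : Type*) [Field K]
    [Algebra (PowerSeries A) K] [FaithfulSMul (PowerSeries A) K] (hL : Function.Injective L)
    {i j : ι} (h1 : P.root j ≠ P.root i) (h2 : P.root j ≠ -P.root i) :
    ∑ n ∈ Finset.range 24, commSeries P L b ((cyc P)^[n] (i, j)).1 ((cyc P)^[n] (i, j)).2 = 0 := by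
  obtain ⟨hper, m, hm⟩ := cyc_iterate_of_ne P i j h1 h2
  have hx (i : ι) : L (P.coroot i) ≠ 0 := (map_ne_zero_iff L hL).mpr (P.ne_zero' i)
  have hLneg (i : ι) : L (P.coroot (P.reflectionPerm i i)) = -L (P.coroot i) := by
    rw [coroot_reflectionPerm_self, map_neg]
  have hsum {i j k : ι} (h : P.coroot i + P.coroot j + P.coroot k = 0) :
      L (P.coroot i) + L (P.coroot j) + L (P.coroot k) = 0 := by
    rw [← map_add, ← map_add, h, map_zero]
  let x (i : ι) : K := (linK K (L (P.coroot i)))⁻¹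
  let h (i : ι) : K := cothK K (L (P.coroot i))
  let s (i : ι) : K := rootSign b i * piK A K
  have hxneg (i : ι) : x (P.reflectionPerm i i) = -x i := by
    simp only [x, hLneg, linK_neg, inv_neg]
  have hhneg (i : ι) : h (P.reflectionPerm i i) = -h i := by
    simp only [h, hLneg, cothK_neg (hx i)]
  have hsneg (i : ι) : s (P.reflectionPerm i i) = -s i := by
    simp only [s, rootSign_neg, Int.cast_neg, neg_mul]
  have e1 := hm K x 0 hxneg fun i j k hijk => by
    have h0 := hsum hijk
    have hi := linK_ne_zero (K := K) (hx i)
    have hj := linK_ne_zero (K := K) (hx j)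
    have hk := linK_ne_zero (K := K) (hx k)
    have h3 := congrArg (linK K) h0
    rw [linK_add, linK_add, linK, linK, linK, linK, map_zero, zero_mul, map_zero, ← linK, ← linK,
      ← linK] at h3
    simp only [x]
    field_simp
    linear_combination h3
  have e2 := hm K h (-piK A K ^ 2) hhneg fun i j k hijk =>
    cothK_relation (hx i) (hx j) (hx k) (hsum hijk)
  have e3 := hm K s (-piK A K ^ 2) hsneg fun i j k hijk => by
    have := congrArg (Int.cast (R := K)) (rootSign_relation b hijk)
    push_cast at this
    simp only [s]
    linear_combination piK A K ^ 2 * this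
  -- The 24 steps close up, so a sum over them is unchanged by shifting the starting point.
  have hshift (f : ι × ι → K) : ∑ n ∈ Finset.range 24, f (cyc P ((cyc P)^[n] (i, j))) =
      ∑ n ∈ Finset.range 24, f ((cyc P)^[n] (i, j)) := by
    have := Finset.sum_range_succ' (fun n => f ((cyc P)^[n] (i, j))) 24
    rw [Finset.sum_range_succ, hper, Function.iterate_zero, id, add_left_inj] at this
    rw [this]
    simp only [Function.iterate_succ_apply']
  have hF (i : ι) : algebraMap (PowerSeries A) K (evalAt (L (P.coroot i)) oddTrig) = h i - x i := by
    simp [h, x, cothK]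
  -- Evaluating at the pair (β, -s_β α) makes the reflected root equal to -α, so oddness expresses
  -- everything through α, β and -s_β α.
  have hG (p : ι × ι) : algebraMap (PowerSeries A) K (commSeries P L b (cyc P p).1 (cyc P p).2) =
      s (cyc P p).1 * s (cyc P p).2 + x (cyc P p).1 * x (cyc P p).2 - h p.1 * h p.2 +
        (h p.2 * x p.1 - s p.2 * (h p.1 - x p.1)) -
        (h (cyc P p).2 * x (cyc P p).1 - s (cyc P p).2 * (h (cyc P p).1 - x (cyc P p).1)) := by
    obtain ⟨i, j⟩ := p
    have hd := congrArg (algebraMap (PowerSeries A) K)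
      (mul_divDiff P L j (P.reflectionPerm j (P.reflectionPerm i i)))
    rw [P.reflectionPerm_self, map_mul, ← linK, map_sub, hF, hF, hxneg, hhneg] at hd
    have hd' : algebraMap (PowerSeries A) K (divDiff P L j
        (P.reflectionPerm j (P.reflectionPerm i i))) = x j *
        (h (P.reflectionPerm j (P.reflectionPerm i i)) -
          x (P.reflectionPerm j (P.reflectionPerm i i)) - (-h i - -x i)) := by
      rw [← hd]
      simp only [x]
      rw [inv_mul_cancel_left₀ (linK_ne_zero (hx j))]
    rw [cyc_apply]
    simp only [commSeries, signedTrig]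
    rw [P.reflectionPerm_self, map_sub, hd', map_mul, map_add, map_add, hF, hF, map_zsmul,
      map_zsmul, ← piK, hxneg, hhneg]
    simp only [s, zsmul_eq_mul]
    ring
  refine FaithfulSMul.algebraMap_injective (PowerSeries A) K ?_
  rw [map_zero, map_sum, ← hshift fun p => algebraMap _ K (commSeries P L b p.1 p.2)]
  simp only [hG, Finset.sum_sub_distrib, Finset.sum_add_distrib]
  rw [hshift fun p => s p.1 * s p.2, hshift fun p => x p.1 * x p.2,
    hshift fun p => h p.2 * x p.1, hshift fun p => s p.2 * (h p.1 - x p.1), e1, e2, e3]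
  ring

theorem sum_commSeries_eq_zero [IsDomain A] (hL : Function.Injective L)
    {i j : ι} (h1 : P.root j ≠ P.root i) (h2 : P.root j ≠ -P.root i) :
    ∑ n ∈ Finset.range 24, commSeries P L b ((cyc P)^[n] (i, j)).1 ((cyc P)^[n] (i, j)).2 = 0 :=
  sum_commSeries_eq_zero_of_field P L b (FractionRing (PowerSeries A)) hL h1 h2

end Upstairs

/-! ### A commutator formula -/

/-- The one-root terms, containing `E` (the ħ-derivative) and `Y` (the commutator of y with a
reflection), carry the weight p i * q i. This is symmetric in p and q, so they cancel in the
commutator. The divided difference terms of the two mixed commutators combine to the same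
antisymmetric weight as the product of the two sums. -/
theorem commutator_formula {R ι : Type*} [Ring R] [Algebra ℂ R] [Fintype ι] (p q : ι → ℂ)
    {yu yv : R} {C Z E s Y : ι → R} {Z' D : ι → ι → R} (hC : ∀ i a, C i * a = a * C i)
    (hsZ : ∀ i j, s i * Z j = Z' i j * s i)
    (hZu : ∀ i, yu * Z i - Z i * yu =
      p i • E i - (1 / 2 : ℂ) • ∑ j, p j • (C j * D j i * s j))
    (hZv : ∀ i, yv * Z i - Z i * yv =
      q i • E i - (1 / 2 : ℂ) • ∑ j, q j • (C j * D j i * s j))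
    (hsu : ∀ i, yu * s i - s i * yu = p i • (Y i * s i))
    (hsv : ∀ i, yv * s i - s i * yv = q i • (Y i * s i))
    (hy : yu * yv = yv * yu) :
    (yu + (1 / 2 : ℂ) • ∑ i, p i • (C i * Z i * s i)) *
        (yv + (1 / 2 : ℂ) • ∑ i, q i • (C i * Z i * s i)) -
      (yv + (1 / 2 : ℂ) • ∑ i, q i • (C i * Z i * s i)) *
        (yu + (1 / 2 : ℂ) • ∑ i, p i • (C i * Z i * s i)) =
    (1 / 4 : ℂ) • ∑ i, ∑ j, (p i * q j - q i * p j) •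
      (C i * C j * (Z i * Z' i j - D i j) * (s i * s j)) := by
  have key (y : R) (p : ι → ℂ) (hZ : ∀ i, y * Z i - Z i * y =
      p i • E i - (1 / 2 : ℂ) • ∑ j, p j • (C j * D j i * s j))
      (hs : ∀ i, y * s i - s i * y = p i • (Y i * s i)) (i : ι) :
      y * (C i * Z i * s i) - C i * Z i * s i * y =
        p i • (C i * (E i + Z i * Y i) * s i) -
          (1 / 2 : ℂ) • ∑ j, p j • (C j * C i * D j i * (s j * s i)) := by
    have h1 : y * (C i * Z i * s i) - C i * Z i * s i * y =
        C i * (y * Z i - Z i * y) * s i + C i * Z i * (y * s i - s i * y) := by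
      have := hC i y
      calc _ = y * C i * Z i * s i - C i * Z i * s i * y := by noncomm_ring
        _ = C i * y * Z i * s i - C i * Z i * s i * y := by rw [this]
        _ = _ := by noncomm_ring
    rw [h1, hZ, hs, mul_sub, sub_mul, mul_smul_comm, smul_mul_assoc, mul_smul_comm, mul_smul_comm,
      smul_mul_assoc, Finset.mul_sum, Finset.sum_mul, mul_add, add_mul, smul_add,
      ← mul_assoc (C i * Z i), ← mul_assoc (C i) (Z i)]
    have h2 : ∀ j, C i * p j • (C j * D j i * s j) * s i =
        p j • (C j * C i * D j i * (s j * s i)) := by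
      intro j
      rw [mul_smul_comm, smul_mul_assoc, hC j (C i)]
      simp only [mul_assoc]
    simp only [h2]
    abel
  have hT (i j : ι) : (C i * Z i * s i) * (C j * Z j * s j) =
      C i * C j * (Z i * Z' i j) * (s i * s j) := by
    calc _ = C i * (Z i * s i * C j) * Z j * s j := by noncomm_ring
      _ = C i * (C j * (Z i * s i)) * Z j * s j := by rw [hC j]
      _ = C i * C j * Z i * (s i * Z j) * s j := by noncomm_ring
      _ = _ := by rw [hsZ]; noncomm_ring
  have hTT : (∑ i, p i • (C i * Z i * s i)) * (∑ i, q i • (C i * Z i * s i)) -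
      (∑ i, q i • (C i * Z i * s i)) * (∑ i, p i • (C i * Z i * s i)) =
      ∑ i, ∑ j, (p i * q j - q i * p j) • (C i * C j * (Z i * Z' i j) * (s i * s j)) := by
    rw [Finset.sum_mul_sum, Finset.sum_mul_sum, ← Finset.sum_sub_distrib]
    refine Finset.sum_congr rfl fun i _ => ?_
    rw [← Finset.sum_sub_distrib]
    refine Finset.sum_congr rfl fun j _ => ?_
    rw [smul_mul_smul_comm, smul_mul_smul_comm, hT, sub_smul]
  have hyT (y : R) (p q : ι → ℂ) (hZ : ∀ i, y * Z i - Z i * y =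
      p i • E i - (1 / 2 : ℂ) • ∑ j, p j • (C j * D j i * s j))
      (hs : ∀ i, y * s i - s i * y = p i • (Y i * s i)) :
      y * (∑ i, q i • (C i * Z i * s i)) - (∑ i, q i • (C i * Z i * s i)) * y =
        ∑ i, (p i * q i) • (C i * (E i + Z i * Y i) * s i) -
          (1 / 2 : ℂ) • ∑ i, ∑ j, (p i * q j) • (C i * C j * D i j * (s i * s j)) := by
    rw [Finset.mul_sum, Finset.sum_mul, ← Finset.sum_sub_distrib, Finset.sum_comm (γ := ι),
      Finset.smul_sum, ← Finset.sum_sub_distrib]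
    refine Finset.sum_congr rfl fun i _ => ?_
    rw [mul_smul_comm, smul_mul_assoc, ← smul_sub, key y p hZ hs, smul_sub, smul_smul,
      smul_comm (q i), Finset.smul_sum (r := q i), mul_comm (q i)]
    simp only [smul_smul, mul_comm (q i)]
  have e1 := hyT yu p q hZu hsu
  have e2 := hyT yv q p hZv hsv
  set Tp := ∑ i, p i • (C i * Z i * s i)
  set Tq := ∑ i, q i • (C i * Z i * s i)
  have expand : (yu + (1 / 2 : ℂ) • Tp) * (yv + (1 / 2 : ℂ) • Tq) -
      (yv + (1 / 2 : ℂ) • Tq) * (yu + (1 / 2 : ℂ) • Tp) =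
      (yu * yv - yv * yu) + (1 / 2 : ℂ) • (yu * Tq - Tq * yu) - (1 / 2 : ℂ) • (yv * Tp - Tp * yv) +
        (1 / 4 : ℂ) • (Tp * Tq - Tq * Tp) := by
    simp only [add_mul, mul_add, smul_mul_assoc, mul_smul_comm]
    module
  rw [expand, hy, sub_self, e1, e2, hTT]
  have e3 : ∑ i, ∑ j, (p i * q j - q i * p j) •
      (C i * C j * (Z i * Z' i j - D i j) * (s i * s j)) =
      ∑ i, ∑ j, (p i * q j - q i * p j) • (C i * C j * (Z i * Z' i j) * (s i * s j)) -
      (∑ i, ∑ j, (p i * q j) • (C i * C j * D i j * (s i * s j)) -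
        ∑ i, ∑ j, (q i * p j) • (C i * C j * D i j * (s i * s j))) := by
    simp only [← Finset.sum_sub_distrib, mul_sub, sub_mul, sub_smul, smul_sub]
  rw [e3]
  simp only [mul_comm (q _) (p _)]
  module

/-! ### The invariant form -/

section Form

variable {ι M N : Type*} [Fintype ι] [AddCommGroup M] [Module ℂ M] [AddCommGroup N] [Module ℂ N]
  [FiniteDimensional ℂ N] {P : RootPairing ι ℂ M N}
  {B : LinearMap.BilinForm ℂ N} (hB : B.Nondegenerate)

theorem toLinearMap_formIso (u v : N) : P.toLinearMap (formIso P B hB u) v = B u v := by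
  have : P.toPerfPair (formIso P B hB u) = B.toDual hB u := by simp [formIso]
  exact LinearMap.congr_fun this v

theorem toLinearMap_ext {ξ η : M} (h : ∀ v, P.toLinearMap ξ v = P.toLinearMap η v) : ξ = η :=
  P.toPerfPair.injective (LinearMap.ext h)

theorem toLinearMap_reflection (i : ι) (ξ : M) (v : N) :
    P.toLinearMap (P.reflection i ξ) v = P.toLinearMap ξ (P.coreflection i v) := by
  simp [P.reflection_apply, P.coreflection_apply, mul_comm]

variable (hinv : ∀ (i : ι) (u v : N), B (P.coreflection i u) (P.coreflection i v) = B u v)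

include hinv

theorem reflection_formIso (i : ι) (u : N) :
    P.reflection i (formIso P B hB u) = formIso P B hB (P.coreflection i u) :=
  toLinearMap_ext fun v => by
    rw [toLinearMap_reflection, toLinearMap_formIso, toLinearMap_formIso, ← hinv i,
      P.coreflection_same]

/-- Invariance under s_α gives (α^∨|v) = (-α^∨ | v - α(v) α^∨), which is solved for (α^∨|v). -/
theorem form_coroot (i : ι) (v : N) :
    B (P.coroot i) v = B (P.coroot i) (P.coroot i) / 2 * P.root' i v := by
  have h := hinv i (P.coroot i) v
  rw [P.coreflection_apply_self, P.coreflection_apply, map_neg, LinearMap.neg_apply, map_sub,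
    map_smul, smul_eq_mul] at h
  linear_combination -h / 2

theorem formIso_coroot (i : ι) :
    formIso P B hB (P.coroot i) = (B (P.coroot i) (P.coroot i) / 2) • P.root i :=
  toLinearMap_ext fun v => by
    rw [toLinearMap_formIso, form_coroot hinv, map_smul]; rfl

include hB in
theorem form_coroot_self_ne_zero (i : ι) : B (P.coroot i) (P.coroot i) ≠ 0 := by
  intro h
  have h' := formIso_coroot hB hinv i
  rw [h, zero_div, zero_smul, LinearEquiv.map_eq_zero_iff] at h'
  exact P.ne_zero' i h'

/-- The normalization 2/(α|α) of c_α is exactly the proportionality factor between π(α^∨) and α. -/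
theorem two_div_rootNormSq (i : ι) :
    2 / rootNormSq P B hB i = B (P.coroot i) (P.coroot i) / 2 := by
  have h0 := form_coroot_self_ne_zero hB hinv i
  have h1 : (formIso P B hB).symm (P.root i) =
      (2 / B (P.coroot i) (P.coroot i)) • P.coroot i := by
    rw [LinearEquiv.symm_apply_eq, map_smul, formIso_coroot hB hinv, smul_smul,
      div_mul_div_comm, mul_comm, div_self (mul_ne_zero h0 two_ne_zero), one_smul]
  rw [rootNormSq, h1, map_smul, map_smul, LinearMap.smul_apply, smul_eq_mul, smul_eq_mul]
  field_simp

theorem rootNormSq_reflectionPerm (j i : ι) :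
    2 / rootNormSq P B hB (P.reflectionPerm j i) = 2 / rootNormSq P B hB i := by
  rw [two_div_rootNormSq hB hinv, two_div_rootNormSq hB hinv, P.coroot_reflectionPerm, hinv]

end Form

/-! ### Relations in the rational Cherednik algebra -/

section Relations

variable {ι M N : Type*} [Fintype ι] [AddCommGroup M] [Module ℂ M] [AddCommGroup N] [Module ℂ N]
  {P : RootPairing ι ℂ M N} [P.IsCrystallographic] [P.IsReduced] [P.IsRootSystem] (b : P.Base)

namespace RCA

theorem mkHom_eq {f g : FreeAlgebra ℂ (CherednikGen P)} (h : CherednikRel b f g) :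
    mkHom b f = mkHom b g := RingQuot.mkAlgHom_rel ℂ h

theorem hbar_comm (a : RCA b) : hbar b * a = a * hbar b := by
  obtain ⟨f, rfl⟩ := mkHom_surjective b a
  induction f using FreeAlgebra.induction with
  | grade0 r => rw [AlgHom.commutes, Algebra.commutes]
  | grade1 a =>
    have := mkHom_eq b (.hbar_central a)
    rwa [map_mul, map_mul] at this
  | mul a a' h h' => rw [map_mul, ← mul_assoc, h, mul_assoc, h', mul_assoc]
  | add a a' h h' => rw [map_add, mul_add, add_mul, h, h']

theorem c_comm (i : ι) (a : RCA b) : c b i * a = a * c b i := by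
  obtain ⟨f, rfl⟩ := mkHom_surjective b a
  induction f using FreeAlgebra.induction with
  | grade0 r => rw [AlgHom.commutes, Algebra.commutes]
  | grade1 a =>
    have := mkHom_eq b (.c_central i a)
    rwa [map_mul, map_mul] at this
  | mul a a' h h' => rw [map_mul, ← mul_assoc, h, mul_assoc, h', mul_assoc]
  | add a a' h h' => rw [map_add, mul_add, add_mul, h, h']

theorem c_reflectionPerm (j i : ι) : c b (P.reflectionPerm j i) = c b i :=
  mkHom_eq b (.c_invariant i j)

theorem w_one : w b 1 = 1 := by
  have := mkHom_eq b .w_one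
  rwa [map_one] at this

theorem w_mul (g h : P.weylGroup) : w b (g * h) = w b g * w b h := by
  have := mkHom_eq b (.w_mul g h)
  rwa [map_mul] at this

/-- The elements of `𝔥*`. -/
def xLin : M →ₗ[ℂ] RCA b where
  toFun := x b
  map_add' ξ η := by
    have := mkHom_eq b (.x_add ξ η)
    rwa [map_add] at this
  map_smul' r ξ := by
    have := mkHom_eq b (.x_smul r ξ)
    rwa [map_smul] at this

theorem y_add (u v : N) : y b (u + v) = y b u + y b v := by
  have := mkHom_eq b (.y_add u v)
  rwa [map_add] at this

theorem y_smul (r : ℂ) (u : N) : y b (r • u) = r • y b u := by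
  have := mkHom_eq b (.y_smul r u)
  rwa [map_smul] at this

theorem x_comm (ξ η : M) : x b ξ * x b η = x b η * x b ξ := by
  have := mkHom_eq b (.x_comm ξ η)
  rwa [map_mul, map_mul] at this

theorem y_comm (u v : N) : y b u * y b v = y b v * y b u := by
  have := mkHom_eq b (.y_comm u v)
  rwa [map_mul, map_mul] at this

theorem w_refl_mul_x (i : ι) (ξ : M) :
    w b (refl P i) * x b ξ = x b (P.reflection i ξ) * w b (refl P i) := by
  have := mkHom_eq b (.w_x (refl P i) ξ)
  rwa [map_mul, map_mul] at this

theorem coact_refl (i : ι) (u : N) : coact (refl P i) u = P.coreflection i u := by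
  have h : (refl P i)⁻¹ = refl P i := Subtype.ext (RootPairing.Equiv.reflection_inv P i)
  rw [coact, h]
  exact LinearEquiv.congr_fun (RootPairing.Equiv.reflection_coweightEquiv P i) u

theorem w_refl_mul_y (i : ι) (u : N) :
    w b (refl P i) * y b u = y b (P.coreflection i u) * w b (refl P i) := by
  have := mkHom_eq b (.w_y (refl P i) u)
  rw [map_mul, map_mul, coact_refl] at this
  exact this

theorem y_mul_w_refl (i : ι) (u : N) :
    y b u * w b (refl P i) - w b (refl P i) * y b u =
      P.root' i u • (y b (P.coroot i) * w b (refl P i)) := by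
  have h : y b u = y b (P.coreflection i u) + P.root' i u • y b (P.coroot i) := by
    rw [← y_smul, ← y_add, P.coreflection_apply, sub_add_cancel]
  rw [w_refl_mul_y, ← sub_mul, ← smul_mul_assoc, ← eq_sub_of_add_eq' h.symm]

theorem refl_mul_self (i : ι) : refl P i * refl P i = 1 := by
  have h : (refl P i)⁻¹ = refl P i := Subtype.ext (RootPairing.Equiv.reflection_inv P i)
  exact (mul_eq_one_iff_inv_eq).mpr h

theorem y_x (u : N) (ξ : M) :
    y b u * x b ξ = x b ξ * y b u + (P.toLinearMap ξ u • hbar b -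
      ∑ i ∈ posRoots b, (P.root' i u * P.coroot' i ξ) • (c b i * w b (refl P i))) := by
  have := mkHom_eq b (.y_x u ξ)
  simp only [map_sub, map_mul, map_smul, map_sum] at this
  exact eq_add_of_sub_eq' this

/-- The Leibniz rule: moving s_α to the right past powers of x(ξ) replaces them by powers of x(s_α
ξ), and the resulting sum is the divided difference of ξ^n, free of denominators. -/
theorem y_x_pow (u : N) (ξ : M) (n : ℕ) :
    y b u * x b ξ ^ n - x b ξ ^ n * y b u =
      (n * P.toLinearMap ξ u) • (hbar b * x b ξ ^ (n - 1)) -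
        ∑ i ∈ posRoots b, (P.root' i u * P.coroot' i ξ) • (c b i *
          (∑ k ∈ Finset.range n, x b ξ ^ k * x b (P.reflection i ξ) ^ (n - 1 - k)) *
            w b (refl P i)) := by
  induction n with
  | zero => simp
  | succ n ih =>
    have h1 : y b u * x b ξ ^ (n + 1) - x b ξ ^ (n + 1) * y b u =
        (y b u * x b ξ ^ n - x b ξ ^ n * y b u) * x b ξ +
          x b ξ ^ n * (y b u * x b ξ - x b ξ * y b u) := by
      rw [pow_succ]; noncomm_ring
    rw [h1, ih, y_x, add_sub_cancel_left, sub_mul, mul_sub, Finset.sum_mul, Finset.mul_sum]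
    have h2 : (n * P.toLinearMap ξ u) • (hbar b * x b ξ ^ (n - 1)) * x b ξ =
        (n * P.toLinearMap ξ u) • (hbar b * x b ξ ^ n) := by
      cases n with
      | zero => simp
      | succ n => rw [smul_mul_assoc, mul_assoc, Nat.add_sub_cancel, ← pow_succ]
    have h3 (i : ι) : (P.root' i u * P.coroot' i ξ) • (c b i *
          (∑ k ∈ Finset.range (n + 1), x b ξ ^ k * x b (P.reflection i ξ) ^ (n + 1 - 1 - k)) *
            w b (refl P i)) = (P.root' i u * P.coroot' i ξ) • (c b i *
          (∑ k ∈ Finset.range n, x b ξ ^ k * x b (P.reflection i ξ) ^ (n - 1 - k)) *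
            w b (refl P i)) * x b ξ +
          x b ξ ^ n * ((P.root' i u * P.coroot' i ξ) • (c b i * w b (refl P i))) := by
      rw [smul_mul_assoc, mul_smul_comm, ← smul_add, mul_assoc _ _ (x b ξ), w_refl_mul_x,
        ← mul_assoc _ (c b i), ← c_comm, mul_assoc (c b i) (∑ k ∈ Finset.range n, _),
        ← mul_assoc (∑ k ∈ Finset.range n, _), ← mul_assoc (c b i), ← add_mul, ← mul_add,
        Finset.sum_range_succ, Finset.sum_mul]
      congr 4
      · refine Finset.sum_congr rfl fun k hk => ?_
        have hk := Finset.mem_range.mp hk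
        rw [mul_assoc, ← pow_succ]
        congr 2
        omega
      · simp
    simp only [h3, Finset.sum_add_distrib]
    rw [h2, mul_smul_comm, ← hbar_comm, Nat.add_sub_cancel]
    push_cast
    module

end RCA

/-- Sums over all roots are preferred because reflections and `cyc` permute them without regard to
positivity. -/
theorem sum_posRoots {V : Type*} [AddCommGroup V] [Module ℂ V] (f : ι → V)
    (hf : ∀ i, f (P.reflectionPerm i i) = f i) :
    ∑ i ∈ posRoots b, f i = (1 / 2 : ℂ) • ∑ i, f i := by
  classical
  have h1 : ∑ i with ¬ b.IsPos i, f i = ∑ i with b.IsPos i, f i := by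
    refine Finset.sum_bij' (fun i _ => P.reflectionPerm i i) (fun i _ => P.reflectionPerm i i)
      ?_ ?_ ?_ ?_ ?_
    · intro i hi
      have := RootPairing.Base.IsPos.neg_iff_not b i
      rw [RootPairing.indexNeg_neg] at this
      simp_all
    · intro i hi
      have := RootPairing.Base.IsPos.neg_iff_not b i
      rw [RootPairing.indexNeg_neg] at this
      simp_all
    · exact fun i _ => P.root.injective (by simp only [root_reflectionPerm_self, neg_neg])
    · exact fun i _ => P.root.injective (by simp only [root_reflectionPerm_self, neg_neg])
    · exact fun i _ => (hf i).symm
  have h2 := Finset.sum_filter_add_sum_filter_not Finset.univ b.IsPos f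
  rw [h1] at h2
  rw [← h2, posRoots]
  module

end Relations

/-! ### Products of reflections, and the elements to be shown to commute -/

section

variable {ι M N : Type*} [Fintype ι] [AddCommGroup M] [Module ℂ M] [AddCommGroup N] [Module ℂ N]
  {P : RootPairing ι ℂ M N} [P.IsCrystallographic] [P.IsReduced] [P.IsRootSystem] (b : P.Base)

theorem refl_reflectionPerm (j i : ι) :
    refl P (P.reflectionPerm j i) = refl P j * refl P i * refl P j := by
  refine Subtype.ext (RootPairing.Equiv.weightHom_injective P ?_)
  simp only [Subgroup.coe_mul, map_mul]
  change (RootPairing.Equiv.reflection P _).weightEquiv =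
    (RootPairing.Equiv.reflection P _).weightEquiv *
    (RootPairing.Equiv.reflection P _).weightEquiv *
    (RootPairing.Equiv.reflection P _).weightEquiv
  simp only [RootPairing.Equiv.reflection_weightEquiv, P.reflection_reflectionPerm]

theorem refl_neg (i : ι) : refl P (P.reflectionPerm i i) = refl P i := by
  rw [refl_reflectionPerm, RCA.refl_mul_self, one_mul]

/-- The reflection in -s_β α is s_β s_α s_β, and s_β s_β s_α s_β = s_α s_β. -/
theorem refl_mul_refl_cyc (p : ι × ι) :
    refl P (cyc P p).1 * refl P (cyc P p).2 = refl P p.1 * refl P p.2 := by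
  rw [cyc_apply, refl_reflectionPerm, refl_neg, ← mul_assoc, ← mul_assoc, RCA.refl_mul_self,
    one_mul]

/-! ### The symmetric algebra of `𝔥*` in the rational Cherednik algebra -/

namespace RCA

instance : IsMulCommutative (Algebra.adjoin ℂ (Set.range (x b))) :=
  Algebra.isMulCommutative_adjoin ℂ (by rintro _ ⟨ξ, rfl⟩ _ ⟨η, rfl⟩; exact x_comm b ξ η)

open scoped IsMulCommutative in
/-- The homomorphism `S𝔥* → H`. -/
def symHom : SymmetricAlgebra ℂ M →ₐ[ℂ] RCA b :=
  (Subalgebra.val (Algebra.adjoin ℂ (Set.range (x b)))).comp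
    (SymmetricAlgebra.lift (R := ℂ) (M := M) (A := Algebra.adjoin ℂ (Set.range (x b)))
      ((xLin b).codRestrict (Subalgebra.toSubmodule (Algebra.adjoin ℂ (Set.range (x b))))
        fun ξ => Algebra.subset_adjoin ⟨ξ, rfl⟩))

open scoped IsMulCommutative in
theorem symHom_ι (ξ : M) : symHom b (SymmetricAlgebra.ι ℂ M ξ) = x b ξ := by
  rw [symHom, AlgHom.comp_apply, SymmetricAlgebra.lift_ι_apply]
  rfl

end RCA

/-- Linear functionals separate the points of `M`, and each extends to the symmetric algebra. -/
theorem ι_injective : Function.Injective (SymmetricAlgebra.ι ℂ M) := by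
  rw [injective_iff_map_eq_zero]
  intro ξ h
  refine (Module.forall_dual_apply_eq_zero_iff ℂ ξ).mp fun f => ?_
  rw [← SymmetricAlgebra.lift_ι_apply f, h, map_zero]

/-! ### Commuting elements in power series over the rational Cherednik algebra -/

theorem coeff_smul' (n : ℕ) (r : ℂ) (f : PowerSeries (RCA b)) :
    PowerSeries.coeff n (r • f) = r • PowerSeries.coeff n f := rfl

theorem C_smul (r : ℂ) (a : RCA b) : PowerSeries.C (r • a) = r • PowerSeries.C a := by
  ext n
  rw [coeff_smul', PowerSeries.coeff_C, PowerSeries.coeff_C]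
  split_ifs <;> simp

variable [FiniteDimensional ℂ N] {B : LinearMap.BilinForm ℂ N} (hB : B.Nondegenerate)

/-- The map `u ↦ π(u)` from `𝔥` to the symmetric algebra of `𝔥*`. -/
def symForm (P : RootPairing ι ℂ M N) : N →ₗ[ℂ] SymmetricAlgebra ℂ M :=
  (SymmetricAlgebra.ι ℂ M).comp (formIso P B hB).toLinearMap

theorem symForm_injective : Function.Injective (symForm hB P) :=
  ι_injective.comp (formIso P B hB).injective

theorem symHom_symForm (u : N) :
    RCA.symHom b (symForm hB P u) = RCA.x b (formIso P B hB u) :=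
  RCA.symHom_ι b _

/-- The element `c_α` in degree two, multiplied by `2 / (α|α)`. -/
def cSer (i : ι) : PowerSeries (RCA b) :=
  (2 / rootNormSq P B hB i) • (PowerSeries.C (RCA.c b i) * PowerSeries.X ^ 2)

/-- The element `s_α`. -/
def wSer (i : ι) : PowerSeries (RCA b) := PowerSeries.C (RCA.w b (refl P i))

/-- The element `y(u)` in degree one. -/
def ySer (u : N) : PowerSeries (RCA b) := PowerSeries.X * PowerSeries.C (RCA.y b u)

/-- The power series `signedTrig` evaluated in the rational Cherednik algebra. -/
def zSer (i j : ι) : PowerSeries (RCA b) :=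
  PowerSeries.map (RCA.symHom b).toRingHom (signedTrig P (symForm hB P) b i j)

/-- The elements `-2πi φ(x(u))`. -/
def dunkl (u : N) : PowerSeries (RCA b) :=
  ySer b u + (1 / 2 : ℂ) • ∑ i, P.root' i u • (cSer b hB i * zSer b hB i i * wSer b i)

theorem coeff_zSer (i j : ι) (n : ℕ) :
    PowerSeries.coeff n (zSer b hB i j) =
      PowerSeries.coeff n oddTrig • RCA.x b (formIso P B hB (P.coroot i)) ^ n +
        if n = 0 then (rootSign b j * (twoPiI / 2)) • (1 : RCA b) else 0 := by
  rw [zSer, PowerSeries.coeff_map, signedTrig, map_add, coeff_evalAt, map_zsmul,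
    PowerSeries.coeff_C]
  change RCA.symHom b _ = _
  rw [map_add, map_smul, map_pow, symHom_symForm, map_zsmul]
  split_ifs
  · rw [AlgHom.commutes, Algebra.algebraMap_eq_smul_one, mul_smul, Int.cast_smul_eq_zsmul]
  · simp

theorem cSer_comm (i : ι) (f : PowerSeries (RCA b)) : cSer b hB i * f = f * cSer b hB i := by
  rw [cSer, smul_mul_assoc, mul_smul_comm, mul_assoc, ← (PowerSeries.commute_X_pow f 2).eq,
    ← mul_assoc, ← mul_assoc]
  congr 2
  ext n
  rw [PowerSeries.coeff_C_mul, PowerSeries.coeff_mul_C, RCA.c_comm]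

variable (hinv : ∀ (i : ι) (u v : N), B (P.coreflection i u) (P.coreflection i v) = B u v)
  (hsymm : B.IsSymm)

theorem wSer_mul_self (i : ι) : wSer b i * wSer b i = 1 := by
  rw [wSer, ← map_mul, ← RCA.w_mul, RCA.refl_mul_self, RCA.w_one, map_one]

theorem wSer_mul (i j : ι) :
    wSer b i * wSer b j = wSer b (P.reflectionPerm i j) * wSer b i := by
  rw [wSer, wSer, wSer, ← map_mul, ← map_mul, ← RCA.w_mul, ← RCA.w_mul, refl_reflectionPerm,
    mul_assoc (refl P i * refl P j), RCA.refl_mul_self, mul_one]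

theorem wSer_neg (i : ι) : wSer b (P.reflectionPerm i i) = wSer b i := by
  rw [wSer, refl_neg, wSer]

theorem ySer_comm (u v : N) : ySer b u * ySer b v = ySer b v * ySer b u := by
  have h (u v : N) : ySer b u * ySer b v =
      PowerSeries.X * PowerSeries.X * PowerSeries.C (RCA.y b u * RCA.y b v) := by
    rw [ySer, ySer, map_mul, mul_assoc, ← mul_assoc (PowerSeries.C _), ← PowerSeries.X_mul]
    simp only [mul_assoc]
  rw [h, h, RCA.y_comm]

theorem ySer_wSer (i : ι) (u : N) :
    ySer b u * wSer b i - wSer b i * ySer b u =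
      P.root' i u • (ySer b (P.coroot i) * wSer b i) := by
  have h := congrArg PowerSeries.C (RCA.y_mul_w_refl b i u)
  rw [map_sub, map_mul, map_mul] at h
  rw [ySer, wSer, ← mul_assoc (PowerSeries.C _), ← PowerSeries.X_mul, mul_assoc, mul_assoc,
    ← mul_sub, h, C_smul, mul_smul_comm, map_mul, ySer, mul_assoc]

theorem wSer_mul_ySer (i : ι) (u : N) :
    wSer b i * ySer b u = ySer b (P.coreflection i u) * wSer b i := by
  rw [wSer, ySer, ySer, ← mul_assoc, ← PowerSeries.X_mul, mul_assoc, mul_assoc, ← map_mul,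
    ← map_mul, RCA.w_refl_mul_y]

include hinv

theorem cSer_reflectionPerm (j i : ι) : cSer b hB (P.reflectionPerm j i) = cSer b hB i := by
  rw [cSer, cSer, rootNormSq_reflectionPerm hB hinv, RCA.c_reflectionPerm]

/-- The reflection moves the argument x_{α^∨} but commutes with the constant ±πi. For this reason
`signedTrig` and `zSer` keep separate indices for the root and for the sign. -/
theorem wSer_mul_zSer (i j k : ι) :
    wSer b i * zSer b hB j k = zSer b hB (P.reflectionPerm i j) k * wSer b i := by
  have h (ξ : M) (n : ℕ) : RCA.w b (refl P i) * RCA.x b ξ ^ n =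
      RCA.x b (P.reflection i ξ) ^ n * RCA.w b (refl P i) := by
    induction n with
    | zero => simp
    | succ n ih => rw [pow_succ, pow_succ, ← mul_assoc, ih, mul_assoc, RCA.w_refl_mul_x, mul_assoc]
  ext n
  rw [wSer, PowerSeries.coeff_C_mul, PowerSeries.coeff_mul_C, coeff_zSer, coeff_zSer, mul_add,
    add_mul, mul_smul_comm, h, smul_mul_assoc, reflection_formIso hB hinv, P.coroot_reflectionPerm]
  congr 1
  split_ifs <;> simp

include hsymm

/-- `y_x_pow` summed against the coefficients of F; the constant ±πi does not contribute. The factor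
⟨β^∨, π(α^∨)⟩ is 2/(β|β) times a Cartan integer: the first is absorbed in `cSer`, the second in
`divDiff`. -/
theorem ySer_mul_zSer (u : N) (i : ι) :
    ySer b u * zSer b hB i i - zSer b hB i i * ySer b u =
      P.root' i u • (PowerSeries.X * PowerSeries.mk fun n =>
        (PowerSeries.coeff n oddTrig * n * (2 / rootNormSq P B hB i)) •
          (RCA.hbar b * RCA.x b (formIso P B hB (P.coroot i)) ^ (n - 1))) -
      (1 / 2 : ℂ) • ∑ j, P.root' j u • (cSer b hB j *
        PowerSeries.map (RCA.symHom b).toRingHom (divDiff P (symForm hB P) j i) * wSer b j) := by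
  have hξ : ∀ v, P.toLinearMap (formIso P B hB (P.coroot i)) v =
      2 / rootNormSq P B hB i * P.root' i v := fun v => by
    rw [toLinearMap_formIso, form_coroot hinv, two_div_rootNormSq hB hinv]
  have hc (j : ι) : P.coroot' j (formIso P B hB (P.coroot i)) =
      2 / rootNormSq P B hB j * P.pairing j i := by
    rw [two_div_rootNormSq hB hinv]
    change P.toLinearMap (formIso P B hB (P.coroot i)) (P.coroot j) = _
    rw [toLinearMap_formIso, hsymm.eq, form_coroot hinv]
    rfl
  have hcomm (n : ℕ) : RCA.y b u * PowerSeries.coeff n (zSer b hB i i) -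
      PowerSeries.coeff n (zSer b hB i i) * RCA.y b u = PowerSeries.coeff n oddTrig •
        (RCA.y b u * RCA.x b (formIso P B hB (P.coroot i)) ^ n -
          RCA.x b (formIso P B hB (P.coroot i)) ^ n * RCA.y b u) := by
    rw [coeff_zSer, mul_add, add_mul, mul_smul_comm, smul_mul_assoc, smul_sub]
    split_ifs
    · simp
    · simp
  have hD (j : ι) (n : ℕ) : PowerSeries.coeff n
      (PowerSeries.map (RCA.symHom b).toRingHom (divDiff P (symForm hB P) j i)) =
      (PowerSeries.coeff (n + 1) oddTrig * P.pairing j i) • ∑ k ∈ Finset.range (n + 1),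
        RCA.x b (formIso P B hB (P.coroot i)) ^ k *
          RCA.x b (P.reflection j (formIso P B hB (P.coroot i))) ^ (n - k) := by
    rw [PowerSeries.coeff_map, divDiff, PowerSeries.coeff_mk]
    change RCA.symHom b _ = _
    simp only [map_smul, map_sum, map_mul, map_pow, symHom_symForm, P.coroot_reflectionPerm,
      reflection_formIso hB hinv]
  have hsum (n : ℕ) : ∑ j ∈ posRoots b,
      (P.root' j u * P.coroot' j (formIso P B hB (P.coroot i))) • (RCA.c b j *
        (∑ k ∈ Finset.range n, RCA.x b (formIso P B hB (P.coroot i)) ^ k *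
          RCA.x b (P.reflection j (formIso P B hB (P.coroot i))) ^ (n - 1 - k)) *
            RCA.w b (refl P j)) = (1 / 2 : ℂ) • ∑ j,
      (P.root' j u * P.coroot' j (formIso P B hB (P.coroot i))) • (RCA.c b j *
        (∑ k ∈ Finset.range n, RCA.x b (formIso P B hB (P.coroot i)) ^ k *
          RCA.x b (P.reflection j (formIso P B hB (P.coroot i))) ^ (n - 1 - k)) *
            RCA.w b (refl P j)) := by
    refine sum_posRoots b _ fun j => ?_
    have h1 : P.root' (P.reflectionPerm j j) u = -P.root' j u := by
      simp [RootPairing.root']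
    have h2 (ξ : M) : P.coroot' (P.reflectionPerm j j) ξ = -P.coroot' j ξ := by
      simp [RootPairing.coroot']
    have h3 (ξ : M) : P.reflection (P.reflectionPerm j j) ξ = P.reflection j ξ := by
      rw [P.reflection_apply, P.reflection_apply, h2, root_reflectionPerm_self, neg_smul_neg]
    rw [h1, h2, neg_mul_neg, RCA.c_reflectionPerm, refl_neg]
    simp only [h3]
  -- `cSer` sits in degree two and `divDiff` lowers the index by one, so degree n + 1 meets the
  -- coefficient of F of index n; for n = 0 both sides vanish.
  have hterm (j : ι) (n : ℕ) : PowerSeries.coeff (n + 1) (cSer b hB j *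
      PowerSeries.map (RCA.symHom b).toRingHom (divDiff P (symForm hB P) j i) * wSer b j) =
      PowerSeries.coeff n oddTrig • P.coroot' j (formIso P B hB (P.coroot i)) • (RCA.c b j *
        (∑ k ∈ Finset.range n, RCA.x b (formIso P B hB (P.coroot i)) ^ k *
          RCA.x b (P.reflection j (formIso P B hB (P.coroot i))) ^ (n - 1 - k)) *
            RCA.w b (refl P j)) := by
    rw [wSer, PowerSeries.coeff_mul_C, cSer, smul_mul_assoc, coeff_smul', mul_assoc,
      PowerSeries.coeff_C_mul, pow_two, mul_assoc, PowerSeries.coeff_succ_X_mul]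
    cases n with
    | zero => simp
    | succ n =>
      rw [PowerSeries.coeff_succ_X_mul, hD, hc, Nat.add_sub_cancel, mul_smul_comm, smul_mul_assoc,
        smul_mul_assoc, smul_smul, smul_smul]
      congr 1
      ring
  have hX : ySer b u * zSer b hB i i - zSer b hB i i * ySer b u =
      PowerSeries.X * (PowerSeries.C (RCA.y b u) * zSer b hB i i -
        zSer b hB i i * PowerSeries.C (RCA.y b u)) := by
    rw [ySer, mul_sub, mul_assoc, ← mul_assoc (zSer b hB i i), ← PowerSeries.X_mul, mul_assoc]
  rw [hX]
  ext n
  rw [map_sub, coeff_smul', coeff_smul', map_sum]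
  simp only [coeff_smul']
  cases n with
  | zero =>
    simp [cSer, mul_assoc, pow_two]
  | succ n =>
    simp only [PowerSeries.coeff_succ_X_mul, hterm]
    rw [map_sub, PowerSeries.coeff_C_mul, PowerSeries.coeff_mul_C, hcomm, RCA.y_x_pow, hsum, hξ,
      PowerSeries.coeff_mk, smul_sub, smul_comm _ (1 / 2 : ℂ), Finset.smul_sum,
      smul_smul, smul_smul]
    congr 2
    · ring
    · refine Finset.sum_congr rfl fun j _ => ?_
      rw [smul_smul, smul_smul, smul_smul]
      congr 1
      ring

/-- Averaging over the 24 iterates of `cyc` leaves the sum over pairs of roots unchanged. The weight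
ω, the parameters and the group element are constant along an orbit and factor out, so only the
orbit sum of `commSeries` remains. -/
theorem dunkl_comm (u v : N) : dunkl b hB u * dunkl b hB v = dunkl b hB v * dunkl b hB u := by
  rw [← sub_eq_zero, dunkl, dunkl, commutator_formula (fun i => P.root' i u) (fun i => P.root' i v)
    (Y := fun i => ySer b (P.coroot i))
    (Z' := fun i j => zSer b hB (P.reflectionPerm i j) j)
    (D := fun i j => PowerSeries.map (RCA.symHom b).toRingHom (divDiff P (symForm hB P) i j))
    (cSer_comm b hB) (fun i j => wSer_mul_zSer b hB hinv i j j)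
    (ySer_mul_zSer b hB hinv hsymm u) (ySer_mul_zSer b hB hinv hsymm v)
    (fun i => ySer_wSer b i u) (fun i => ySer_wSer b i v) (ySer_comm b u v)]
  have hcs (i j : ι) : zSer b hB i i * zSer b hB (P.reflectionPerm i j) j -
      PowerSeries.map (RCA.symHom b).toRingHom (divDiff P (symForm hB P) i j) =
      PowerSeries.map (RCA.symHom b).toRingHom (commSeries P (symForm hB P) b i j) := by
    rw [commSeries, map_sub, map_mul, zSer, zSer]
  simp only [hcs]
  let ω (p : ι × ι) : ℂ := P.root' p.1 u * P.root' p.2 v - P.root' p.1 v * P.root' p.2 u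
  let G (p : ι × ι) : PowerSeries (RCA b) := PowerSeries.map (RCA.symHom b).toRingHom
    (commSeries P (symForm hB P) b p.1 p.2)
  let F (p : ι × ι) : PowerSeries (RCA b) :=
    ω p • (cSer b hB p.1 * cSer b hB p.2 * G p * (wSer b p.1 * wSer b p.2))
  suffices h : ∑ p, F p = 0 by
    rw [← Fintype.sum_prod_type' (f := fun i j => F (i, j))]
    exact (congrArg _ h).trans (smul_zero _)
  have hω (n : ℕ) (p : ι × ι) : ω ((cyc P)^[n] p) = ω p := by
    induction n with
    | zero => rfl
    | succ n ih =>
      rw [Function.iterate_succ_apply', ← ih]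
      have h2 (i : ι) : P.coroot' i (P.root i) = 2 := P.root_coroot_two i
      simp only [ω, cyc_apply, RootPairing.root', P.root_reflectionPerm, P.reflection_apply, h2,
        map_sub, map_smul, LinearMap.sub_apply, LinearMap.smul_apply, smul_eq_mul]
      ring
  have hC (n : ℕ) (p : ι × ι) : cSer b hB ((cyc P)^[n] p).1 * cSer b hB ((cyc P)^[n] p).2 =
      cSer b hB p.1 * cSer b hB p.2 := by
    induction n with
    | zero => rfl
    | succ n ih =>
      rw [Function.iterate_succ_apply', ← ih, cyc_apply, cSer_reflectionPerm b hB hinv,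
        cSer_reflectionPerm b hB hinv, cSer_comm]
  have hW (n : ℕ) (p : ι × ι) : wSer b ((cyc P)^[n] p).1 * wSer b ((cyc P)^[n] p).2 =
      wSer b p.1 * wSer b p.2 := by
    induction n with
    | zero => rfl
    | succ n ih =>
      rw [Function.iterate_succ_apply', ← ih]
      simp only [wSer, ← map_mul, ← RCA.w_mul, refl_mul_refl_cyc]
  have hF (n : ℕ) : ∑ p, F ((cyc P)^[n] p) = ∑ p, F p := by
    rw [Equiv.Perm.iterate_eq_pow]
    exact Equiv.sum_comp ((cyc P) ^ n) F
  have hsum : (24 : ℂ) • ∑ p, F p = 0 := by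
    calc (24 : ℂ) • ∑ p, F p = ∑ n ∈ Finset.range 24, ∑ p, F ((cyc P)^[n] p) := by
          simp only [hF, Finset.sum_const, Finset.card_range, ← Nat.cast_smul_eq_nsmul ℂ]
          norm_num
      _ = ∑ p, ∑ n ∈ Finset.range 24, F ((cyc P)^[n] p) := Finset.sum_comm
      _ = 0 := Finset.sum_eq_zero fun p _ => ?_
    simp only [F, hω, hC, hW, ← Finset.smul_sum, ← Finset.mul_sum, ← Finset.sum_mul, G,
      ← map_sum]
    -- For equal or opposite roots, to which the rank two lemma does not apply, the antisymmetric
    -- weight ω is zero.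
    by_cases h1 : P.root p.2 = P.root p.1
    · simp only [ω, RootPairing.root', h1]
      rw [mul_comm, sub_self, zero_smul]
    by_cases h2 : P.root p.2 = -P.root p.1
    · simp only [ω, RootPairing.root', h2, map_neg, LinearMap.neg_apply]
      rw [mul_neg, mul_neg, mul_comm, sub_self, zero_smul]
    rw [sum_commSeries_eq_zero P (symForm hB P) b (symForm_injective hB) h1 h2]
    simp
  exact (smul_eq_zero.mp hsum).resolve_left (by norm_num)

omit hsymm in
-- Conjugation by s_i reproduces the sum for s_i u except that each root keeps the sign of its
-- preimage. The discrepancy sgn(s_i α) - sgn(α) is nonzero only for α = ±α_i, where s_α s_i = 1.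
theorem wSer_mul_dunkl {i : ι} (hi : i ∈ b.support) (u : N) :
    wSer b i * dunkl b hB u - dunkl b hB (P.coreflection i u) * wSer b i =
      (twoPiI * P.root' i u) • cSer b hB i := by
  classical
  have h1 (j : ι) : wSer b i * (cSer b hB j * zSer b hB j j * wSer b j) =
      cSer b hB (P.reflectionPerm i j) * zSer b hB (P.reflectionPerm i j) j *
        wSer b (P.reflectionPerm i j) * wSer b i := by
    rw [← mul_assoc, ← mul_assoc, ← cSer_comm, mul_assoc (cSer b hB j), wSer_mul_zSer b hB hinv,
      mul_assoc, mul_assoc, mul_assoc, wSer_mul, cSer_reflectionPerm b hB hinv, mul_assoc]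
  have h2 : ∑ j, P.root' j u • (wSer b i * (cSer b hB j * zSer b hB j j * wSer b j)) =
      ∑ j, P.root' j (P.coreflection i u) • (cSer b hB j *
        zSer b hB j (P.reflectionPerm i j) * wSer b j * wSer b i) := by
    rw [← Equiv.sum_comp (P.reflectionPerm i)]
    refine Finset.sum_congr rfl fun j _ => ?_
    rw [h1, P.reflectionPerm_self]
    congr 1
    change P.toLinearMap _ _ = P.toLinearMap _ _
    rw [← toLinearMap_reflection, P.root_reflectionPerm]
  have h3 (j : ι) : zSer b hB j (P.reflectionPerm i j) - zSer b hB j j =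
      (((rootSign b (P.reflectionPerm i j) : ℂ) - rootSign b j) * (twoPiI / 2)) • 1 := by
    ext n
    rw [map_sub, coeff_zSer, coeff_zSer, coeff_smul', PowerSeries.coeff_one, add_sub_add_left_eq_sub]
    split_ifs
    · module
    · simp
  have h4 : wSer b i * dunkl b hB u - dunkl b hB (P.coreflection i u) * wSer b i =
      (1 / 2 : ℂ) • ∑ j, (P.root' j (P.coreflection i u) *
        (((rootSign b (P.reflectionPerm i j) : ℂ) - rootSign b j) * (twoPiI / 2))) •
          (cSer b hB j * wSer b j * wSer b i) := by
    rw [dunkl, dunkl, mul_add, add_mul, wSer_mul_ySer, add_sub_add_left_eq_sub, mul_smul_comm,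
      smul_mul_assoc, ← smul_sub, Finset.mul_sum, Finset.sum_mul]
    simp only [mul_smul_comm, smul_mul_assoc]
    rw [h2, ← Finset.sum_sub_distrib]
    congr 1
    refine Finset.sum_congr rfl fun j _ => ?_
    rw [← smul_sub, ← sub_mul, ← sub_mul, ← mul_sub, h3, mul_smul_comm, mul_one, smul_mul_assoc,
      smul_mul_assoc, smul_smul]
  have hne : i ≠ P.reflectionPerm i i := by
    intro h
    have h' := congrArg P.root h
    rw [root_reflectionPerm_self, eq_neg_iff_add_eq_zero, ← two_smul ℂ] at h'
    exact P.ne_zero i ((smul_eq_zero.mp h').resolve_left two_ne_zero)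
  have hpos : rootSign b i = 1 := if_pos (RootPairing.Base.isPos_of_mem_support hi)
  rw [h4, Fintype.sum_eq_add i (P.reflectionPerm i i) hne]
  · rw [P.reflectionPerm_self, wSer_neg, cSer_reflectionPerm b hB hinv, mul_assoc, wSer_mul_self,
      mul_one, rootSign_neg, hpos]
    have e1 : P.root' i (P.coreflection i u) = -P.root' i u := by
      change P.toLinearMap _ _ = - P.toLinearMap _ _
      rw [← toLinearMap_reflection, P.reflection_apply_self, map_neg]; rfl
    have e2 : P.root' (P.reflectionPerm i i) (P.coreflection i u) = P.root' i u := by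
      change P.toLinearMap _ _ = P.toLinearMap _ _
      rw [← toLinearMap_reflection, root_reflectionPerm_self, map_neg, P.reflection_apply_self,
        neg_neg]
    rw [e1, e2, ← add_smul, smul_smul]
    congr 1
    push_cast
    ring
  · rintro j ⟨h5, h6⟩
    rw [rootSign_reflectionPerm b hi h5 h6]
    simp

end

namespace RCA

variable {ι M N : Type*} [Fintype ι] [AddCommGroup M] [Module ℂ M] [AddCommGroup N] [Module ℂ N]
  {P : RootPairing ι ℂ M N} [P.IsCrystallographic] [P.IsReduced] [P.IsRootSystem] (b : P.Base)

/-! ### The Rees algebra and its specialization in the completion -/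

/-- The power series whose `n`-th coefficient has degree at least `n`. -/
def rees : Subalgebra ℂ (PowerSeries (RCA b)) where
  carrier := {p | ∀ n, PowerSeries.coeff n p ∈ fil b n}
  mul_mem' {p p'} h h' n := by
    rw [PowerSeries.coeff_mul]
    refine Ideal.sum_mem _ fun x hx => ?_
    rw [← Finset.HasAntidiagonal.mem_antidiagonal.mp hx]
    exact mul_mem_filSpan b (h x.1) (h' x.2)
  add_mem' {p p'} h h' n := by rw [map_add]; exact Ideal.add_mem _ (h n) (h' n)
  algebraMap_mem' r n := by
    rw [PowerSeries.algebraMap_apply, PowerSeries.coeff_C]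
    split_ifs with h0
    · rw [h0]; exact mem_filSpan_zero b _
    · exact Ideal.zero_mem _

theorem monomial_mem_rees {n : ℕ} {a : RCA b} (ha : a ∈ fil b n) :
    PowerSeries.C a * PowerSeries.X ^ n ∈ rees b := by
  intro m
  rw [PowerSeries.coeff_C_mul_X_pow]
  split_ifs with h
  · rwa [h]
  · exact Ideal.zero_mem _

/-- The value of a power series in `rees` at `t = 1`. -/
def atOne : rees b →ₐ[ℂ] completion b where
  toFun p := series b (fun n => PowerSeries.coeff n p.1) p.2
  map_one' := by
    refine Subtype.ext (funext fun n => ?_)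
    cases n with
    -- At level zero the truncated sum is empty, but the quotient by all elements of degree at least
    -- 0 is trivial.
    | zero => exact Ideal.Quotient.eq.mpr (mem_filSpan_zero b _)
    | succ n =>
      change Ideal.Quotient.mk _ (∑ i ∈ Finset.range (n + 1), PowerSeries.coeff i 1) = 1
      simp [PowerSeries.coeff_one]
  map_mul' p p' := by
    refine Subtype.ext (funext fun n => ?_)
    change Ideal.Quotient.mk (fil b n) (∑ i ∈ Finset.range n, PowerSeries.coeff i (p.1 * p'.1)) =
      Ideal.Quotient.mk (fil b n) (∑ i ∈ Finset.range n, PowerSeries.coeff i p.1) *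
        Ideal.Quotient.mk (fil b n) (∑ i ∈ Finset.range n, PowerSeries.coeff i p'.1)
    rw [← map_mul, eq_comm, Ideal.Quotient.eq, Finset.sum_mul_sum, ← Finset.sum_product']
    -- The product of truncations runs over a square, the truncation of the product over the
    -- triangle below its diagonal; the remaining terms have degree at least n.
    have h : ∑ i ∈ Finset.range n, PowerSeries.coeff i (p.1 * p'.1) =
        ∑ x ∈ Finset.range n ×ˢ Finset.range n with x.1 + x.2 < n,
          PowerSeries.coeff x.1 p.1 * PowerSeries.coeff x.2 p'.1 := by
      rw [← Finset.sum_fiberwise_of_maps_to (t := Finset.range n) (g := fun x : ℕ × ℕ => x.1 + x.2)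
        fun x hx => Finset.mem_range.mpr (Finset.mem_filter.mp hx).2]
      refine Finset.sum_congr rfl fun i hi => ?_
      rw [PowerSeries.coeff_mul]
      refine Finset.sum_congr ?_ fun _ _ => rfl
      ext x
      simp only [Finset.HasAntidiagonal.mem_antidiagonal, Finset.mem_filter, Finset.mem_product,
        Finset.mem_range] at hi ⊢
      omega
    rw [h, ← Finset.sum_filter_add_sum_filter_not _ (fun x : ℕ × ℕ => x.1 + x.2 < n),
      add_sub_cancel_left]
    refine Ideal.sum_mem _ fun x hx => ?_
    exact fil_anti b (not_lt.mp (Finset.mem_filter.mp hx).2)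
      (mul_mem_filSpan b (p.2 x.1) (p'.2 x.2))
  map_zero' := by
    refine Subtype.ext (funext fun n => ?_)
    change Ideal.Quotient.mk _ (∑ i ∈ Finset.range n, PowerSeries.coeff i 0) = 0
    simp
  map_add' p p' := by
    refine Subtype.ext (funext fun n => ?_)
    change Ideal.Quotient.mk (fil b n) (∑ i ∈ Finset.range n, PowerSeries.coeff i (p.1 + p'.1)) =
      Ideal.Quotient.mk (fil b n) (∑ i ∈ Finset.range n, PowerSeries.coeff i p.1) +
        Ideal.Quotient.mk (fil b n) (∑ i ∈ Finset.range n, PowerSeries.coeff i p'.1)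
    simp [Finset.sum_add_distrib]
  commutes' r := by
    refine Subtype.ext (funext fun n => ?_)
    cases n with
    | zero => exact Ideal.Quotient.eq.mpr (mem_filSpan_zero b _)
    | succ n =>
      change Ideal.Quotient.mk _ (∑ i ∈ Finset.range (n + 1), PowerSeries.coeff i
        (algebraMap ℂ (PowerSeries (RCA b)) r)) = Ideal.Quotient.mk _ (algebraMap ℂ (RCA b) r)
      rw [PowerSeries.algebraMap_apply]
      simp [PowerSeries.coeff_C]

theorem atOne_monomial {n : ℕ} {a : RCA b} (ha : a ∈ fil b n) :
    atOne b ⟨_, monomial_mem_rees b ha⟩ = toCompletion b a := by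
  refine Subtype.ext (funext fun m => ?_)
  change Ideal.Quotient.mk _ (∑ i ∈ Finset.range m, PowerSeries.coeff i
    (PowerSeries.C a * PowerSeries.X ^ n)) = Ideal.Quotient.mk _ a
  simp only [PowerSeries.coeff_C_mul_X_pow, Finset.sum_ite_eq', Finset.mem_range]
  split_ifs with h
  · rfl
  · rw [map_zero, eq_comm, Ideal.Quotient.eq_zero_iff_mem]
    exact fil_anti b (not_lt.mp h) ha

theorem evalx_mem_rees (p : PowerSeries ℂ) (ξ : M) :
    (PowerSeries.mk fun n => PowerSeries.coeff n p • x b ξ ^ n) ∈ rees b := by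
  intro n
  rw [PowerSeries.coeff_mk]
  exact (filSpan b n).smul_mem _ (x_pow_mem b ξ n)

theorem atOne_evalx (p : PowerSeries ℂ) (ξ : M) :
    atOne b ⟨_, evalx_mem_rees b p ξ⟩ = evalx b p ξ := by
  refine Subtype.ext (funext fun m => ?_)
  change Ideal.Quotient.mk (fil b m) (∑ i ∈ Finset.range m, PowerSeries.coeff i
    (PowerSeries.mk fun n => PowerSeries.coeff n p • x b ξ ^ n)) =
    Ideal.Quotient.mk (fil b m) (∑ i ∈ Finset.range m, PowerSeries.coeff i p • x b ξ ^ i)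
  simp only [PowerSeries.coeff_mk]

end RCA

/-! ### The generators in the Rees algebra -/

section

variable {ι M N : Type*} [Fintype ι] [AddCommGroup M] [Module ℂ M] [AddCommGroup N] [Module ℂ N]
  {P : RootPairing ι ℂ M N} [P.IsCrystallographic] [P.IsReduced] [P.IsRootSystem] (b : P.Base)
  [FiniteDimensional ℂ N] {B : LinearMap.BilinForm ℂ N} (hB : B.Nondegenerate)

/-- The element `c_α` of `rees`, multiplied by `2 / (α|α)`. -/
def cRees (i : ι) : RCA.rees b :=
  (2 / rootNormSq P B hB i) • ⟨_, RCA.monomial_mem_rees b (RCA.gen_mem_filSpan b (.c i))⟩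

theorem coe_cRees (i : ι) : (cRees b hB i : PowerSeries (RCA b)) = cSer b hB i := rfl

/-- The element `w` of `rees`. -/
def wRees (g : P.weylGroup) : RCA.rees b :=
  ⟨_, RCA.monomial_mem_rees b (RCA.gen_mem_filSpan b (.w g))⟩

theorem coe_wRees_refl (i : ι) :
    (wRees b (refl P i) : PowerSeries (RCA b)) = wSer b i := by
  change PowerSeries.C _ * PowerSeries.X ^ 0 = _
  rw [pow_zero, mul_one]; rfl

/-- The element `y(u)` of `rees`. -/
def yRees (u : N) : RCA.rees b :=
  ⟨_, RCA.monomial_mem_rees b (RCA.gen_mem_filSpan b (.y u))⟩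

theorem coe_yRees (u : N) : (yRees b u : PowerSeries (RCA b)) = ySer b u := by
  change PowerSeries.C _ * PowerSeries.X ^ 1 = _
  rw [pow_one, ← PowerSeries.X_mul]; rfl

/-- The element `oddTrig + πi sign` of `rees`, evaluated at the coroot. -/
def zRees (i : ι) : RCA.rees b :=
  ⟨_, RCA.evalx_mem_rees b oddTrig (formIso P B hB (P.coroot i))⟩ +
    (rootSign b i * (twoPiI / 2) : ℂ) • 1

theorem coe_zRees (i : ι) : (zRees b hB i : PowerSeries (RCA b)) = zSer b hB i i := by
  ext n
  rw [coeff_zSer, zRees, Subalgebra.coe_add, Subalgebra.coe_smul, map_add, coeff_smul',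
    PowerSeries.coeff_mk, Subalgebra.coe_one, PowerSeries.coeff_one]
  split_ifs <;> simp

/-- The elements `-2πi φ(x(u))` of `rees`. -/
def dunklRees (u : N) : RCA.rees b :=
  yRees b u + (1 / 2 : ℂ) • ∑ i, P.root' i u •
    (cRees b hB i * zRees b hB i * wRees b (refl P i))

theorem coe_dunklRees (u : N) : (dunklRees b hB u : PowerSeries (RCA b)) = dunkl b hB u := by
  simp only [dunklRees, Subalgebra.coe_add, Subalgebra.coe_smul, dunkl, ← coe_yRees, ← coe_cRees,
    ← coe_zRees, ← coe_wRees_refl, ← Subalgebra.coe_mul, AddSubmonoidClass.coe_finsetSum]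

theorem atOne_cRees (i : ι) : RCA.atOne b (cRees b hB i) =
    (2 / rootNormSq P B hB i) • RCA.toCompletion b (RCA.c b i) := by
  rw [cRees, map_smul]
  exact congrArg _ (RCA.atOne_monomial b (RCA.gen_mem_filSpan b (.c i)))

theorem atOne_wRees (g : P.weylGroup) :
    RCA.atOne b (wRees b g) = RCA.toCompletion b (RCA.w b g) :=
  RCA.atOne_monomial b (RCA.gen_mem_filSpan b (.w g))

theorem atOne_yRees (u : N) : RCA.atOne b (yRees b u) = RCA.toCompletion b (RCA.y b u) :=
  RCA.atOne_monomial b (RCA.gen_mem_filSpan b (.y u))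

/-- For a positive root the sign contributes +πi, which completes the odd part to `trigSeries`. -/
theorem atOne_zRees {i : ι} (hi : b.IsPos i) :
    RCA.atOne b (zRees b hB i) = RCA.evalx b trigSeries (formIso P B hB (P.coroot i)) := by
  rw [← RCA.atOne_evalx]
  congr 1
  refine Subtype.ext (PowerSeries.ext fun n => ?_)
  rw [zRees, Subalgebra.coe_add, Subalgebra.coe_smul, map_add, coeff_smul',
    PowerSeries.coeff_mk, PowerSeries.coeff_mk, Subalgebra.coe_one, PowerSeries.coeff_one,
    trigSeries_eq, map_add, PowerSeries.coeff_C, rootSign, if_pos hi, add_smul]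
  split_ifs with h <;> simp [h]

variable (hinv : ∀ (i : ι) (u v : N), B (P.coreflection i u) (P.coreflection i v) = B u v)
  (hsymm : B.IsSymm)

include hinv in
-- Both α(u) and Z_α change sign with α, while c_α and s_α do not, so opposite roots contribute
-- equally.
theorem dunklRees_eq (u : N) : dunklRees b hB u = yRees b u +
    ∑ i ∈ posRoots b, P.root' i u • (cRees b hB i * zRees b hB i * wRees b (refl P i)) := by
  rw [sum_posRoots b _ fun i => ?_]
  · rfl
  have h1 : P.root' (P.reflectionPerm i i) u = -P.root' i u := by
    simp [RootPairing.root']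
  have h2 : cRees b hB (P.reflectionPerm i i) = cRees b hB i :=
    Subtype.ext (cSer_reflectionPerm b hB hinv i i)
  have h3 : zRees b hB (P.reflectionPerm i i) = (-1 : ℂ) • zRees b hB i := by
    refine Subtype.ext (PowerSeries.ext fun n => ?_)
    rw [Subalgebra.coe_smul, coeff_smul', coe_zRees, coe_zRees, coeff_zSer, coeff_zSer,
      coroot_reflectionPerm_self, map_neg, rootSign_neg]
    have h4 : RCA.x b (-formIso P B hB (P.coroot i)) = -RCA.x b (formIso P B hB (P.coroot i)) :=
      map_neg (RCA.xLin b) _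
    have h5 : PowerSeries.coeff n oddTrig * (-1) ^ n = -PowerSeries.coeff n oddTrig := by
      rw [mul_comm, coeff_oddTrig]
    rw [h4, ← neg_one_smul ℂ (RCA.x b _), smul_pow, smul_smul, h5]
    split_ifs
    · push_cast
      module
    · module
  rw [h1, h2, h3, refl_neg]
  rw [mul_smul_comm, smul_mul_assoc, smul_smul, neg_mul_neg, mul_one]

theorem dunklRees_add (u v : N) :
    dunklRees b hB (u + v) = dunklRees b hB u + dunklRees b hB v := by
  have h : yRees b (u + v) = yRees b u + yRees b v := by
    refine Subtype.ext ?_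
    rw [Subalgebra.coe_add, coe_yRees, coe_yRees, coe_yRees, ySer, RCA.y_add, map_add, mul_add]
    rfl
  simp only [dunklRees, h, map_add, add_smul, Finset.sum_add_distrib, smul_add]
  abel

theorem dunklRees_smul (r : ℂ) (u : N) : dunklRees b hB (r • u) = r • dunklRees b hB u := by
  have h : yRees b (r • u) = r • yRees b u := by
    refine Subtype.ext ?_
    rw [Subalgebra.coe_smul, coe_yRees, coe_yRees, ySer, RCA.y_smul, C_smul, mul_smul_comm]
    rfl
  simp only [dunklRees, h, map_smul, smul_add, smul_eq_mul, mul_smul, ← Finset.smul_sum]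
  rw [smul_comm r (1 / 2 : ℂ)]

/-! ### The homomorphism from the degenerate affine Hecke algebra -/

/-- The images of the generators. -/
def heckeGenImage : HeckeGen P → RCA.completion b
  | .k i => (-1 : ℂ) • RCA.atOne b (cRees b hB i)
  | .w g => RCA.atOne b (wRees b g)
  | .x u => -twoPiI⁻¹ • RCA.atOne b (dunklRees b hB u)

theorem cRees_comm (i : ι) (p : RCA.rees b) : cRees b hB i * p = p * cRees b hB i :=
  Subtype.ext (cSer_comm b hB i p)

include hinv hsymm in
theorem heckeGenImage_rel {p q : FreeAlgebra ℂ (HeckeGen P)} (h : HeckeRel b p q) :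
    FreeAlgebra.lift ℂ (heckeGenImage b hB) p = FreeAlgebra.lift ℂ (heckeGenImage b hB) q := by
  have hc (i : ι) (p : RCA.rees b) : RCA.atOne b (cRees b hB i) * RCA.atOne b p =
      RCA.atOne b p * RCA.atOne b (cRees b hB i) := by
    rw [← map_mul, cRees_comm, map_mul]
  induction h with
  | k_central i a =>
    simp only [map_mul, FreeAlgebra.lift_ι_apply]
    cases a with
    | k j => simp only [heckeGenImage, smul_mul_assoc, mul_smul_comm, hc i (cRees b hB j)]
    | w g => simp only [heckeGenImage, smul_mul_assoc, mul_smul_comm, hc]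
    | x u =>
      simp only [heckeGenImage, smul_mul_assoc, mul_smul_comm, hc]
      rw [smul_comm]
  | k_invariant i j =>
    simp only [FreeAlgebra.lift_ι_apply, heckeGenImage]
    rw [show cRees b hB (P.reflectionPerm j i) = cRees b hB i from
      Subtype.ext (cSer_reflectionPerm b hB hinv j i)]
  | w_one =>
    rw [FreeAlgebra.lift_ι_apply, heckeGenImage, atOne_wRees, RCA.w_one, map_one, map_one]
  | w_mul g h =>
    simp only [map_mul, FreeAlgebra.lift_ι_apply, heckeGenImage, atOne_wRees, RCA.w_mul]
  | x_add u v =>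
    simp only [map_add, FreeAlgebra.lift_ι_apply, heckeGenImage, dunklRees_add, smul_add]
  | x_smul r u =>
    simp only [map_smul, FreeAlgebra.lift_ι_apply, heckeGenImage, dunklRees_smul]
    rw [smul_comm]
  | x_comm u v =>
    have h : dunklRees b hB u * dunklRees b hB v = dunklRees b hB v * dunklRees b hB u := by
      refine Subtype.ext ?_
      rw [Subalgebra.coe_mul, Subalgebra.coe_mul, coe_dunklRees, coe_dunklRees,
        dunkl_comm b hB hinv hsymm]
    simp only [map_mul, FreeAlgebra.lift_ι_apply, heckeGenImage, smul_mul_assoc, mul_smul_comm]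
    rw [← map_mul, h, map_mul]
  | cross i hi u =>
    -- The factor 2πi is cancelled by the normalization -1/(2πi) of the image of x(u), and the
    -- remaining sign is that of the image of k_α.
    have h : wRees b (refl P i) * dunklRees b hB u -
        dunklRees b hB (P.coreflection i u) * wRees b (refl P i) =
        (twoPiI * P.root' i u) • cRees b hB i := by
      refine Subtype.ext ?_
      rw [Subalgebra.coe_sub, Subalgebra.coe_mul, Subalgebra.coe_mul, coe_dunklRees,
        coe_dunklRees, coe_wRees_refl, wSer_mul_dunkl b hB hinv hi]
      rfl
    rw [map_sub, map_mul, map_mul, map_smul]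
    simp only [FreeAlgebra.lift_ι_apply, heckeGenImage, smul_mul_assoc, mul_smul_comm]
    rw [← smul_sub, ← map_mul, ← map_mul, ← map_sub, h, map_smul, smul_smul, smul_smul]
    congr 1
    field_simp [twoPiI_ne_zero]

/-- The homomorphism from the degenerate affine Hecke algebra to the completed rational Cherednik
algebra. -/
def heckeHom : DAHA b →ₐ[ℂ] RCA.completion b :=
  RingQuot.liftAlgHom ℂ (s := HeckeRel b) ⟨FreeAlgebra.lift ℂ (heckeGenImage b hB),
    fun {_ _} h => heckeGenImage_rel b hB hinv hsymm h⟩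

theorem heckeHom_gen (a : HeckeGen P) :
    heckeHom b hB hinv hsymm (DAHA.gen b a) = heckeGenImage b hB a := by
  refine (RingQuot.liftAlgHom_mkAlgHom_apply ℂ _ _ _).trans ?_
  rw [FreeAlgebra.lift_ι_apply]

theorem heckeHom_w (g : P.weylGroup) :
    heckeHom b hB hinv hsymm (DAHA.w b g) = RCA.toCompletion b (RCA.w b g) :=
  (heckeHom_gen b hB hinv hsymm (.w g)).trans (atOne_wRees b g)

theorem heckeHom_k (i : ι) : heckeHom b hB hinv hsymm (DAHA.k b i) =
    -((2 / rootNormSq P B hB i) • RCA.toCompletion b (RCA.c b i)) := by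
  rw [← atOne_cRees, ← neg_one_smul ℂ]
  exact heckeHom_gen b hB hinv hsymm (.k i)

theorem heckeHom_x (u : N) : twoPiI • heckeHom b hB hinv hsymm (DAHA.x b u) =
    -RCA.toCompletion b (RCA.y b u) - ∑ i ∈ posRoots b,
      (P.root' i u * (2 / rootNormSq P B hB i)) •
        (RCA.toCompletion b (RCA.c b i) * RCA.evalx b trigSeries (formIso P B hB (P.coroot i)) *
          RCA.toCompletion b (RCA.w b (refl P i))) := by
  have h : heckeHom b hB hinv hsymm (DAHA.x b u) = -twoPiI⁻¹ • RCA.atOne b (dunklRees b hB u) :=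
    heckeHom_gen b hB hinv hsymm (.x u)
  rw [h, smul_smul, mul_neg, mul_inv_cancel₀ twoPiI_ne_zero, neg_one_smul,
    dunklRees_eq b hB hinv, map_add, atOne_yRees, neg_add', map_sum]
  congr 1
  refine Finset.sum_congr rfl fun i hi => ?_
  have hi' : b.IsPos i := by
    classical
    exact (Finset.mem_filter.mp hi).2
  rw [map_smul, map_mul, map_mul, atOne_cRees, atOne_zRees b hB hi',
    atOne_wRees, smul_mul_assoc, smul_mul_assoc, smul_smul]

end

/-! ### Limits of coefficients of power series -/

section coeff

variable {α : Type*} {l : Filter α}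

theorem tendsto_coeff_mul {f g : α → PowerSeries ℂ} {F G : PowerSeries ℂ}
    (hf : ∀ n, Tendsto (fun a => PowerSeries.coeff n (f a)) l (𝓝 (PowerSeries.coeff n F)))
    (hg : ∀ n, Tendsto (fun a => PowerSeries.coeff n (g a)) l (𝓝 (PowerSeries.coeff n G)))
    (n : ℕ) : Tendsto (fun a => PowerSeries.coeff n (f a * g a)) l
      (𝓝 (PowerSeries.coeff n (F * G))) := by
  simp only [PowerSeries.coeff_mul]
  exact tendsto_finsetSum _ fun x _ => (hf x.1).mul (hg x.2)

/-- The coefficients of an inverse are given recursively by lower ones and the inverse of the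
constant term, which is continuous away from zero. -/
theorem tendsto_coeff_inv {f : α → PowerSeries ℂ} {F : PowerSeries ℂ}
    (hf : ∀ n, Tendsto (fun a => PowerSeries.coeff n (f a)) l (𝓝 (PowerSeries.coeff n F)))
    (hF : PowerSeries.constantCoeff F ≠ 0) (n : ℕ) :
    Tendsto (fun a => PowerSeries.coeff n (f a)⁻¹) l (𝓝 (PowerSeries.coeff n F⁻¹)) := by
  have h0 : Tendsto (fun a => (PowerSeries.constantCoeff (f a))⁻¹) l
      (𝓝 (PowerSeries.constantCoeff F)⁻¹) := by
    have := hf 0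
    simp only [PowerSeries.coeff_zero_eq_constantCoeff_apply] at this
    exact this.inv₀ hF
  induction n using Nat.strong_induction_on with
  | _ n ih =>
    rw [PowerSeries.coeff_inv]
    refine Tendsto.congr (fun a => (PowerSeries.coeff_inv n (f a)).symm) ?_
    split_ifs with hn
    · exact h0
    · refine h0.neg.mul (tendsto_finsetSum _ fun x _ => ?_)
      split_ifs with hx
      · exact (hf x.1).mul (ih x.2 hx)
      · exact tendsto_const_nhds

theorem tendsto_coeff_divX {f : α → PowerSeries ℂ} {F : PowerSeries ℂ}
    (hf : ∀ n, Tendsto (fun a => PowerSeries.coeff n (f a)) l (𝓝 (PowerSeries.coeff n F)))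
    (n : ℕ) : Tendsto (fun a => PowerSeries.coeff n (divX (f a))) l
      (𝓝 (PowerSeries.coeff n (divX F))) := by
  simp only [divX, PowerSeries.coeff_mk]
  exact hf (n + 1)

theorem tendsto_coeff_C {f : α → ℂ} {r : ℂ} (hf : Tendsto f l (𝓝 r)) (n : ℕ) :
    Tendsto (fun a => PowerSeries.coeff n (PowerSeries.C (f a))) l
      (𝓝 (PowerSeries.coeff n (PowerSeries.C r))) := by
  simp only [PowerSeries.coeff_C]
  split_ifs
  · exact hf
  · exact tendsto_const_nhds

end coeff

/-! ### Degeneration of the theta function -/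

/-- The function `sin(πw) / π`. -/
def sinFun (w : ℂ) : ℂ :=
  (Complex.exp (twoPiI / 2 * w) - Complex.exp (-(twoPiI / 2 * w))) / twoPiI

/-- The factors of the product formula of the theta function are `1 + thetaTerm q w s`. -/
def thetaTerm (q w : ℂ) (s : ℕ) : ℂ :=
  q ^ (s + 1) * (2 - Complex.exp (twoPiI * w) - Complex.exp (-(twoPiI * w))) /
    (1 - q ^ (s + 1)) ^ 2

theorem half_le_norm_one_sub_pow {q : ℂ} (hq : ‖q‖ ≤ 1 / 2) (s : ℕ) :
    1 / 2 ≤ ‖1 - q ^ (s + 1)‖ := by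
  have h1 : ‖q ^ (s + 1)‖ ≤ 1 / 2 := by
    rw [norm_pow, pow_succ]
    exact (mul_le_of_le_one_left (norm_nonneg q)
      (pow_le_one₀ (norm_nonneg q) (hq.trans (by norm_num)))).trans hq
  have h2 := norm_sub_norm_le (1 : ℂ) (q ^ (s + 1))
  rw [norm_one] at h2
  linarith

/-- The 4 bounds 1/|1 - q^{s+1}|². One factor ‖q‖ is kept aside: it makes the product tend to 1,
while the powers of 1/2 give summability uniformly in q. -/
theorem norm_thetaTerm_le {q w : ℂ} {R : ℝ} (hq : ‖q‖ ≤ 1 / 2) (hw : ‖w‖ ≤ R) (s : ℕ) :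
    ‖thetaTerm q w s‖ ≤ 4 * (2 + 2 * Real.exp (‖twoPiI‖ * R)) * ‖q‖ * (1 / 2) ^ s := by
  have h1 := half_le_norm_one_sub_pow hq s
  have h2 : ‖2 - Complex.exp (twoPiI * w) - Complex.exp (-(twoPiI * w))‖ ≤
      2 + 2 * Real.exp (‖twoPiI‖ * R) := by
    have h (c : ℂ) (hc : ‖c‖ = ‖twoPiI * w‖) :
        ‖Complex.exp c‖ ≤ Real.exp (‖twoPiI‖ * R) := by
      refine (Complex.norm_exp_le_exp_norm c).trans (Real.exp_le_exp.mpr ?_)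
      rw [hc, norm_mul]
      gcongr
    refine (norm_sub_le _ _).trans ?_
    have h3 := norm_sub_le 2 (Complex.exp (twoPiI * w))
    have h4 := h _ rfl
    have h5 := h (-(twoPiI * w)) (norm_neg _)
    rw [Complex.norm_ofNat] at h3
    linarith
  have h3 : ‖q ^ (s + 1)‖ ≤ ‖q‖ * (1 / 2) ^ s := by
    rw [norm_pow, pow_succ']
    gcongr
  rw [thetaTerm, norm_div, norm_mul, norm_pow (1 - _), div_le_iff₀ (by positivity)]
  calc ‖q ^ (s + 1)‖ * ‖2 - Complex.exp (twoPiI * w) - Complex.exp (-(twoPiI * w))‖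
      ≤ (‖q‖ * (1 / 2) ^ s) * (2 + 2 * Real.exp (‖twoPiI‖ * R)) := by gcongr
    _ = 4 * (2 + 2 * Real.exp (‖twoPiI‖ * R)) * ‖q‖ * (1 / 2) ^ s * (1 / 2) ^ 2 := by ring
    _ ≤ _ := by gcongr

theorem theta_eq {τ : ℍ} (hq : ‖Complex.exp (twoPiI * τ)‖ ≤ 1 / 2) (w : ℂ) :
    theta w τ = sinFun w * ∏' s, (1 + thetaTerm (Complex.exp (twoPiI * τ)) w s) := by
  rw [theta, sinFun]
  congr 1
  refine tprod_congr fun s => ?_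
  have h : (1 - Complex.exp (twoPiI * τ) ^ (s + 1)) ^ 2 ≠ 0 := by
    refine pow_ne_zero _ (norm_pos_iff.mp ?_)
    linarith [half_le_norm_one_sub_pow hq s]
  have hE : Complex.exp (twoPiI * w) * Complex.exp (-(twoPiI * w)) = 1 := by
    rw [← Complex.exp_add, add_neg_cancel, Complex.exp_zero]
  rw [thetaTerm, div_eq_iff h, add_mul, div_mul_cancel₀ _ h]
  linear_combination (Complex.exp (twoPiI * τ) ^ (s + 1)) ^ 2 * hE

theorem summable_thetaTerm_bound (c : ℝ) : Summable fun s : ℕ => c * (1 / 2 : ℝ) ^ s :=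
  (summable_geometric_of_lt_one (by norm_num) (by norm_num)).mul_left c

theorem hasProdLocallyUniformlyOn_thetaTerm {q : ℂ} (hq : ‖q‖ ≤ 1 / 2) (R : ℝ) :
    HasProdLocallyUniformlyOn (fun s w => 1 + thetaTerm q w s)
      (fun w => ∏' s, (1 + thetaTerm q w s)) (Metric.ball 0 R) := by
  refine Summable.hasProdLocallyUniformlyOn_nat_one_add Metric.isOpen_ball
    (summable_thetaTerm_bound (4 * (2 + 2 * Real.exp (‖twoPiI‖ * R)) * ‖q‖))
    (.of_forall fun s w hw => norm_thetaTerm_le hq (mem_ball_zero_iff.mp hw).le s) fun s => ?_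
  unfold thetaTerm
  fun_prop

theorem differentiable_tprod_thetaTerm {q : ℂ} (hq : ‖q‖ ≤ 1 / 2) :
    Differentiable ℂ fun w => ∏' s, (1 + thetaTerm q w s) := by
  intro w
  have h := (hasProdLocallyUniformlyOn_thetaTerm hq (‖w‖ + 1)).differentiableOn
    (.of_forall fun t => ?_) Metric.isOpen_ball
  · exact h.differentiableAt (Metric.isOpen_ball.mem_nhds (by simp))
  · unfold thetaTerm
    fun_prop

theorem norm_tprod_thetaTerm_sub_one_le {q w : ℂ} {R : ℝ} (hq : ‖q‖ ≤ 1 / 2) (hw : ‖w‖ < R) :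
    ‖∏' s, (1 + thetaTerm q w s) - 1‖ ≤
      Real.exp (4 * (2 + 2 * Real.exp (‖twoPiI‖ * R)) * ‖q‖ * 2) - 1 := by
  have h := ((hasProdLocallyUniformlyOn_thetaTerm hq R).hasProd (mem_ball_zero_iff.mpr hw))
  refine le_of_tendsto ((Tendsto.sub_const h 1).norm) (.of_forall fun t => ?_)
  refine (Finset.norm_prod_one_add_sub_one_le t _).trans ?_
  gcongr
  refine (Finset.sum_le_sum fun s _ => norm_thetaTerm_le hq hw.le s).trans ?_
  refine ((summable_thetaTerm_bound _).sum_le_tsum t fun s _ => by positivity).trans_eq ?_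
  rw [tsum_mul_left, tsum_geometric_two]

theorem tendsto_exp_atImInfty :
    Tendsto (fun τ : ℍ => Complex.exp (twoPiI * τ)) UpperHalfPlane.atImInfty (𝓝 0) := by
  refine (UpperHalfPlane.qParam_tendsto_atImInfty one_pos).congr fun τ => ?_
  simp [Function.Periodic.qParam, twoPiI]

theorem eventually_norm_exp_le :
    ∀ᶠ τ : ℍ in UpperHalfPlane.atImInfty, ‖Complex.exp (twoPiI * τ)‖ ≤ 1 / 2 := by
  have := tendsto_exp_atImInfty.norm
  rw [norm_zero] at this
  exact this.eventually_le_const (by norm_num)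

theorem differentiable_sinFun : Differentiable ℂ sinFun := by
  unfold sinFun
  fun_prop

/-- On a compact set the error is at most sup |sin(πw)/π| times the distance of the infinite product
from 1, and the latter is controlled by |q|. -/
theorem tendstoLocallyUniformlyOn_theta :
    TendstoLocallyUniformlyOn (fun (τ : ℍ) w => theta w τ) sinFun UpperHalfPlane.atImInfty
      Set.univ := by
  rw [tendstoLocallyUniformlyOn_iff_forall_isCompact isOpen_univ]
  intro K _ hK
  obtain ⟨R, hR⟩ := hK.isBounded.subset_ball 0
  obtain ⟨C, hC⟩ := hK.exists_bound_of_continuousOn differentiable_sinFun.continuous.continuousOn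
  rw [Metric.tendstoUniformlyOn_iff]
  intro ε hε
  have hlim : Tendsto (fun τ : ℍ => C * (Real.exp (4 * (2 + 2 * Real.exp (‖twoPiI‖ * R)) *
      ‖Complex.exp (twoPiI * τ)‖ * 2) - 1)) UpperHalfPlane.atImInfty (𝓝 0) := by
    have h := tendsto_exp_atImInfty.norm
    rw [norm_zero] at h
    have h2 := (((h.const_mul (4 * (2 + 2 * Real.exp (‖twoPiI‖ * R)))).mul_const 2).rexp.sub_const
      1).const_mul C
    simpa using h2
  filter_upwards [eventually_norm_exp_le, hlim.eventually_lt_const hε] with τ hq hτ w hw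
  refine lt_of_le_of_lt ?_ hτ
  rw [dist_comm, dist_eq_norm, theta_eq hq, ← mul_sub_one, norm_mul]
  have h1 := norm_tprod_thetaTerm_sub_one_le hq (mem_ball_zero_iff.mp (hR hw))
  exact mul_le_mul (hC w hw) h1 (norm_nonneg _) ((norm_nonneg _).trans (hC w hw))

theorem eventually_differentiable_theta :
    ∀ᶠ τ : ℍ in UpperHalfPlane.atImInfty, Differentiable ℂ fun w => theta w τ := by
  filter_upwards [eventually_norm_exp_le] with τ hq
  simp only [theta_eq hq]
  exact differentiable_sinFun.mul (differentiable_tprod_thetaTerm hq)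

/-- Locally uniform limits of holomorphic functions may be differentiated term by term. -/
theorem tendstoLocallyUniformlyOn_iteratedDeriv {α : Type*} {l : Filter α} [l.NeBot]
    {F : α → ℂ → ℂ} {f : ℂ → ℂ} (hf : TendstoLocallyUniformlyOn F f l Set.univ)
    (hF : ∀ᶠ a in l, Differentiable ℂ (F a)) (n : ℕ) :
    TendstoLocallyUniformlyOn (fun a => iteratedDeriv n (F a)) (iteratedDeriv n f) l
      Set.univ := by
  induction n with
  | zero => simpa only [iteratedDeriv_zero] using hf
  | succ n ih =>
    simp only [iteratedDeriv_succ]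
    refine ih.deriv ?_ isOpen_univ
    filter_upwards [hF] with a ha
    exact ((ha.contDiff (n := (n + 1 : ℕ))).differentiable_iteratedDeriv n
      (by exact_mod_cast n.lt_succ_self)).differentiableOn

/-- The Taylor series at `X = 0` of `sinFun (z + X)`. -/
def sinSeries (z : ℂ) : PowerSeries ℂ :=
  PowerSeries.mk fun n => iteratedDeriv n sinFun z / (n.factorial : ℂ)

theorem tendsto_coeff_thetaSeries (z : ℂ) (n : ℕ) :
    Tendsto (fun τ => PowerSeries.coeff n (thetaSeries z τ)) UpperHalfPlane.atImInfty
      (𝓝 (PowerSeries.coeff n (sinSeries z))) := by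
  have h := (tendstoLocallyUniformlyOn_iteratedDeriv tendstoLocallyUniformlyOn_theta
    eventually_differentiable_theta n).tendsto_at (Set.mem_univ z)
  simpa only [thetaSeries, sinSeries, PowerSeries.coeff_mk] using h.div_const _

/-- The power series `e^{πi X}`. -/
def halfExp : PowerSeries ℂ := PowerSeries.rescale (twoPiI / 2) (PowerSeries.exp ℂ)

/-- The power series `e^{-πi X}`. -/
def halfExpNeg : PowerSeries ℂ := PowerSeries.rescale (-(twoPiI / 2)) (PowerSeries.exp ℂ)

theorem halfExp_mul_halfExp : halfExp * halfExp = expSeries := by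
  rw [halfExp, PowerSeries.exp_mul_exp_eq_exp_add, add_halves, expSeries]

theorem halfExp_mul_halfExpNeg : halfExp * halfExpNeg = 1 := by
  rw [halfExp, halfExpNeg, PowerSeries.exp_mul_exp_eq_exp_add, add_neg_cancel]
  simp

theorem sinSeries_eq (z : ℂ) : sinSeries z = PowerSeries.C twoPiI⁻¹ *
    (PowerSeries.C (Complex.exp (twoPiI / 2 * z)) * halfExp -
      PowerSeries.C (Complex.exp (-(twoPiI / 2 * z))) * halfExpNeg) := by
  have h (c : ℂ) (n : ℕ) : ContDiffAt ℂ n (fun w => Complex.exp (c * w)) z := by fun_prop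
  have hs : sinFun = fun w => twoPiI⁻¹ * (Complex.exp (twoPiI / 2 * w) -
      Complex.exp (-(twoPiI / 2) * w)) := by
    funext w
    rw [sinFun, div_eq_inv_mul, neg_mul]
  ext n
  rw [sinSeries, PowerSeries.coeff_mk, hs, iteratedDeriv_const_mul_field,
    iteratedDeriv_fun_sub (h _ n) (h _ n), iteratedDeriv_cexp_const_mul,
    iteratedDeriv_cexp_const_mul, PowerSeries.coeff_C_mul, map_sub, PowerSeries.coeff_C_mul,
    PowerSeries.coeff_C_mul, halfExp, halfExpNeg, PowerSeries.coeff_rescale,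
    PowerSeries.coeff_rescale, PowerSeries.coeff_exp]
  simp only [neg_mul, map_div₀, map_one, map_natCast]
  ring

theorem sinFun_ne_zero {z : ℂ} (hz : Complex.exp (twoPiI * z) ≠ 1) : sinFun z ≠ 0 := by
  intro h
  rw [sinFun, div_eq_zero_iff, or_iff_left twoPiI_ne_zero, sub_eq_zero] at h
  refine hz ?_
  rw [show twoPiI * z = twoPiI / 2 * z + twoPiI / 2 * z by ring, Complex.exp_add]
  nth_rewrite 2 [h]
  rw [← Complex.exp_add, add_neg_cancel, Complex.exp_zero]

theorem sinSeries_zero : sinSeries 0 = PowerSeries.C twoPiI⁻¹ * (halfExp - halfExpNeg) := by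
  simp [sinSeries_eq]

theorem constantCoeff_halfExp : PowerSeries.constantCoeff halfExp = 1 := by
  rw [← PowerSeries.coeff_zero_eq_constantCoeff_apply, halfExp, PowerSeries.coeff_rescale]
  simp

theorem constantCoeff_halfExpNeg : PowerSeries.constantCoeff halfExpNeg = 1 := by
  rw [← PowerSeries.coeff_zero_eq_constantCoeff_apply, halfExpNeg, PowerSeries.coeff_rescale]
  simp

theorem X_mul_divX_sinSeries : PowerSeries.X * divX (sinSeries 0) = sinSeries 0 := by
  rw [X_mul_divX, sinSeries_zero]
  simp [constantCoeff_halfExp, constantCoeff_halfExpNeg]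

theorem constantCoeff_divX_sinSeries : PowerSeries.constantCoeff (divX (sinSeries 0)) = 1 := by
  rw [constantCoeff_divX, sinSeries_zero, PowerSeries.coeff_C_mul, map_sub, halfExp, halfExpNeg,
    PowerSeries.coeff_rescale, PowerSeries.coeff_rescale, PowerSeries.coeff_exp]
  have := twoPiI_ne_zero
  simp
  field_simp

theorem constantCoeff_sinSeries (z : ℂ) : PowerSeries.constantCoeff (sinSeries z) = sinFun z := by
  rw [← PowerSeries.coeff_zero_eq_constantCoeff_apply, sinSeries, PowerSeries.coeff_mk]
  simp

/-- This is sin(a + b)/(sin a sin b) = cot a + cot b at a = πz, b = πX, with the pole 1/X removed.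
-/
theorem divX_sin_quotient {z : ℂ} (hz : Complex.exp (twoPiI * z) ≠ 1) :
    divX (PowerSeries.C (sinFun z)⁻¹ * sinSeries z * (divX (sinSeries 0))⁻¹ - 1) =
      oddTrig + PowerSeries.C (twoPiI / 2 * ((Complex.exp (twoPiI * z) + 1) /
        (Complex.exp (twoPiI * z) - 1))) := by
  have hs := sinFun_ne_zero hz
  have hD : PowerSeries.constantCoeff (divX (sinSeries 0)) ≠ 0 := by
    rw [constantCoeff_divX_sinSeries]; exact one_ne_zero
  have hD0 : divX (sinSeries 0) ≠ 0 := fun h => hD (by rw [h, map_zero])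
  have hX : (PowerSeries.X : PowerSeries ℂ) ≠ 0 := PowerSeries.X_ne_zero
  have hE0 : halfExp ≠ 0 := left_ne_zero_of_mul_eq_one halfExp_mul_halfExpNeg
  have h2 : (PowerSeries.C twoPiI : PowerSeries ℂ) * PowerSeries.C twoPiI⁻¹ = 1 := by
    rw [← map_mul, mul_inv_cancel₀ twoPiI_ne_zero, map_one]
  have h3 : (PowerSeries.X * trigSeries + 1) * sinSeries 0 = halfExp * PowerSeries.X := by
    refine mul_left_cancel₀ hE0 ?_
    have h := X_mul_trigSeries_mul
    rw [← halfExp_mul_halfExp] at h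
    rw [sinSeries_zero]
    linear_combination (PowerSeries.C twoPiI⁻¹) * h + halfExp * halfExp * PowerSeries.X * h2 -
      (PowerSeries.X * trigSeries + 1) * PowerSeries.C twoPiI⁻¹ * halfExp_mul_halfExpNeg
  -- One factor X undoes `divX`, the factor `divX (sinSeries 0)` clears the inverse, and the other X
  -- turns it into `sinSeries 0`.
  refine mul_left_cancel₀ hX (mul_right_cancel₀ hD0 (mul_left_cancel₀ hX ?_))
  rw [X_mul_divX]
  have hc : PowerSeries.constantCoeff
      (PowerSeries.C (sinFun z)⁻¹ * sinSeries z * (divX (sinSeries 0))⁻¹ - 1) = 0 := by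
    simp [constantCoeff_sinSeries, constantCoeff_divX_sinSeries, hs]
  rw [hc, map_zero, sub_zero, sub_mul, mul_assoc, PowerSeries.inv_mul_cancel _ hD, mul_one,
    one_mul]
  set D := divX (sinSeries 0)
  have hXD : PowerSeries.X * D = sinSeries 0 := X_mul_divX_sinSeries
  have hz' : Complex.exp (twoPiI * z) - 1 ≠ 0 := sub_ne_zero.mpr hz
  have hEz : Complex.exp (twoPiI * z) =
      Complex.exp (twoPiI / 2 * z) * Complex.exp (twoPiI / 2 * z) := by
    rw [← Complex.exp_add]; ring_nf
  have hEn : Complex.exp (twoPiI / 2 * z) * Complex.exp (-(twoPiI / 2 * z)) = 1 := by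
    rw [← Complex.exp_add, add_neg_cancel, Complex.exp_zero]
  have hκ : twoPiI / 2 * ((Complex.exp (twoPiI * z) + 1) / (Complex.exp (twoPiI * z) - 1)) =
      twoPiI / 2 + twoPiI * (Complex.exp (twoPiI * z) - 1)⁻¹ := by
    field_simp
    ring
  have hsin : sinFun z * twoPiI =
      Complex.exp (twoPiI / 2 * z) - Complex.exp (-(twoPiI / 2 * z)) := by
    rw [sinFun, div_mul_cancel₀ _ twoPiI_ne_zero]
  have hT := twoPiI_ne_zero
  have h4 : (sinFun z)⁻¹ * twoPiI⁻¹ * Complex.exp (twoPiI / 2 * z) =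
      1 + (Complex.exp (twoPiI * z) - 1)⁻¹ := by
    rw [← mul_inv, inv_mul_eq_div, div_eq_iff (mul_ne_zero hs hT), hsin]
    generalize Complex.exp (twoPiI * z) = e at hEz hz' ⊢
    generalize Complex.exp (twoPiI / 2 * z) = a at hEn hEz ⊢
    generalize Complex.exp (-(twoPiI / 2 * z)) = a' at hEn ⊢
    field_simp
    linear_combination a' * hEz + a * hEn
  have h5 : (sinFun z)⁻¹ * twoPiI⁻¹ * Complex.exp (-(twoPiI / 2 * z)) =
      (Complex.exp (twoPiI * z) - 1)⁻¹ := by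
    rw [← mul_inv, inv_mul_eq_div, div_eq_iff (mul_ne_zero hs hT), hsin]
    generalize Complex.exp (twoPiI * z) = e at hEz hz' ⊢
    generalize Complex.exp (twoPiI / 2 * z) = a at hEn hEz ⊢
    generalize Complex.exp (-(twoPiI / 2 * z)) = a' at hEn ⊢
    field_simp
    linear_combination a' * hEz + a * hEn
  have h6 : PowerSeries.C (sinFun z)⁻¹ * sinSeries z =
      halfExp + PowerSeries.C (Complex.exp (twoPiI * z) - 1)⁻¹ * (halfExp - halfExpNeg) := by
    have h4' := congrArg (PowerSeries.C (R := ℂ)) h4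
    have h5' := congrArg (PowerSeries.C (R := ℂ)) h5
    rw [map_mul, map_mul, map_add, map_one] at h4'
    rw [map_mul, map_mul] at h5'
    rw [sinSeries_eq]
    linear_combination halfExp * h4' - halfExpNeg * h5'
  rw [h6, hκ, map_add, ← add_assoc, ← trigSeries_eq, map_mul]
  have h7 : PowerSeries.C twoPiI * sinSeries 0 = halfExp - halfExpNeg := by
    rw [sinSeries_zero, ← mul_assoc, h2, one_mul]
  linear_combination (-1 : PowerSeries ℂ) * h3 -
    PowerSeries.X * PowerSeries.C (Complex.exp (twoPiI * z) - 1)⁻¹ * h7 - hXD -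
    PowerSeries.X * (trigSeries + PowerSeries.C twoPiI * PowerSeries.C (Complex.exp (twoPiI * z) - 1)⁻¹) * hXD

theorem tendsto_coeff_kSeries {z : ℂ} (hz : Complex.exp (twoPiI * z) ≠ 1) (n : ℕ) :
    Tendsto (fun τ => PowerSeries.coeff n (kSeries z τ)) UpperHalfPlane.atImInfty
      (𝓝 (PowerSeries.coeff n (oddTrig + PowerSeries.C (twoPiI / 2 *
        ((Complex.exp (twoPiI * z) + 1) / (Complex.exp (twoPiI * z) - 1)))))) := by
  rw [← divX_sin_quotient hz]
  refine tendsto_coeff_divX (fun n => ?_) n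
  simp only [map_sub]
  refine (tendsto_coeff_mul (tendsto_coeff_mul (tendsto_coeff_C ?_)
    (tendsto_coeff_thetaSeries z)) (tendsto_coeff_inv
      (tendsto_coeff_divX (tendsto_coeff_thetaSeries 0)) ?_) n).sub_const _
  · exact (tendstoLocallyUniformlyOn_theta.tendsto_at (Set.mem_univ z)).inv₀ (sinFun_ne_zero hz)
  · rw [constantCoeff_divX_sinSeries]
    exact one_ne_zero

/-! ### Degeneration of the elliptic connection -/

section

variable {ι M N : Type*} [Fintype ι] [AddCommGroup M] [Module ℂ M] [AddCommGroup N] [Module ℂ N]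
  {P : RootPairing ι ℂ M N} [P.IsCrystallographic] [P.IsReduced] [P.IsRootSystem] (b : P.Base)

namespace RCA

theorem evalad_mem_rees (p : PowerSeries ℂ) (ξ : M) (t : RCA b) :
    (PowerSeries.mk fun n => PowerSeries.coeff n p • (adx b ξ)^[n] t) ∈ rees b := by
  intro n
  rw [PowerSeries.coeff_mk]
  exact (filSpan b n).smul_mem _ (adx_iterate_mem b ξ t n)

theorem atOne_evalad (p : PowerSeries ℂ) (ξ : M) (t : RCA b) :
    atOne b ⟨_, evalad_mem_rees b p ξ t⟩ = evalad b p ξ t := by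
  refine Subtype.ext (funext fun m => ?_)
  change Ideal.Quotient.mk (fil b m) (∑ i ∈ Finset.range m, PowerSeries.coeff i
    (PowerSeries.mk fun n => PowerSeries.coeff n p • (adx b ξ)^[n] t)) =
    Ideal.Quotient.mk (fil b m) (∑ i ∈ Finset.range m, PowerSeries.coeff i p • (adx b ξ)^[i] t)
  simp only [PowerSeries.coeff_mk]

theorem evalx_add_C (p : PowerSeries ℂ) (r : ℂ) (ξ : M) :
    evalx b (p + PowerSeries.C r) ξ = evalx b p ξ + r • 1 := by
  rw [← atOne_evalx, ← atOne_evalx, ← map_one (atOne b), ← map_smul, ← map_add]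
  congr 1
  refine Subtype.ext (PowerSeries.ext fun n => ?_)
  rw [Subalgebra.coe_add, Subalgebra.coe_smul, map_add, coeff_smul', Subalgebra.coe_one,
    PowerSeries.coeff_mk, PowerSeries.coeff_mk, PowerSeries.coeff_one, map_add,
    PowerSeries.coeff_C, add_smul]
  split_ifs with h <;> simp [h]

theorem tendsto_evalad {α : Type*} {f : Filter α} {p : α → PowerSeries ℂ} {q : PowerSeries ℂ}
    (hp : ∀ n, Tendsto (fun a => PowerSeries.coeff n (p a)) f (𝓝 (PowerSeries.coeff n q)))
    (ξ : M) (t : RCA b) (n : ℕ) (l : Module.Dual ℂ (RCA b ⧸ fil b n)) :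
    Tendsto (fun a => l ((evalad b (p a) ξ t).1 n)) f (𝓝 (l ((evalad b q ξ t).1 n))) := by
  have h (p : PowerSeries ℂ) : l ((evalad b p ξ t).1 n) = ∑ i ∈ Finset.range n,
      PowerSeries.coeff i p * l (Ideal.Quotient.mkₐ ℂ (fil b n) ((adx b ξ)^[i] t)) := by
    change l (Ideal.Quotient.mkₐ ℂ (fil b n) (∑ i ∈ Finset.range n, _)) = _
    simp only [map_sum, map_smul, smul_eq_mul]
  simp only [h]
  exact tendsto_finsetSum _ fun i _ => (hp i).mul_const _

end RCA

variable [FiniteDimensional ℂ N] {B : LinearMap.BilinForm ℂ N} (hB : B.Nondegenerate)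
  (hinv : ∀ (i : ι) (u v : N), B (P.coreflection i u) (P.coreflection i v) = B u v)
  (hsymm : B.IsSymm)

include hinv in
-- As x_{α^∨} anticommutes with s_α, half the commutator with it multiplies x_{α^∨}^n s_α by
-- x_{α^∨}; this is why the argument of ad is x_{α^∨}/2. The central ħ survives only for n = 0.
theorem adx_iterate_tElt (θ i : ι) (n : ℕ) :
    (RCA.adx b ((1 / 2 : ℂ) • formIso P B hB (P.coroot i)))^[n] (tElt b B hB θ i) =
      (if n = 0 then (dualCoxeter b θ)⁻¹ • RCA.hbar b else 0) - (2 / rootNormSq P B hB i) •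
        (RCA.c b i * (RCA.x b (formIso P B hB (P.coroot i)) ^ n * RCA.w b (refl P i))) := by
  induction n with
  | zero => simp [tElt]
  | succ n ih =>
    set ξ := formIso P B hB (P.coroot i) with hξ
    have hx : RCA.x b ((1 / 2 : ℂ) • ξ) = (1 / 2 : ℂ) • RCA.x b ξ := map_smul (RCA.xLin b) _ _
    have hs : RCA.w b (refl P i) * RCA.x b ξ = -(RCA.x b ξ * RCA.w b (refl P i)) := by
      have h4 : RCA.x b (-ξ) = -RCA.x b ξ := map_neg (RCA.xLin b) _
      rw [RCA.w_refl_mul_x, hξ, reflection_formIso hB hinv, P.coreflection_apply_self, map_neg, h4,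
        neg_mul]
    have h0 : (if n = 0 then (dualCoxeter b θ)⁻¹ • RCA.hbar b else 0) * RCA.x b ξ =
        RCA.x b ξ * (if n = 0 then (dualCoxeter b θ)⁻¹ • RCA.hbar b else 0) := by
      split_ifs
      · rw [smul_mul_assoc, mul_smul_comm, RCA.hbar_comm]
      · simp
    have h1 : RCA.x b ξ * (RCA.c b i * (RCA.x b ξ ^ n * RCA.w b (refl P i))) =
        RCA.c b i * (RCA.x b ξ ^ (n + 1) * RCA.w b (refl P i)) := by
      rw [← mul_assoc, ← RCA.c_comm, mul_assoc, ← mul_assoc (RCA.x b ξ), ← pow_succ']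
    have h2 : RCA.c b i * (RCA.x b ξ ^ n * RCA.w b (refl P i)) * RCA.x b ξ =
        -(RCA.c b i * (RCA.x b ξ ^ (n + 1) * RCA.w b (refl P i))) := by
      rw [mul_assoc, mul_assoc, hs, mul_neg, mul_neg, ← mul_assoc (_ ^ n), ← pow_succ]
    rw [Function.iterate_succ_apply', ih, RCA.adx, hx, if_neg n.succ_ne_zero, smul_mul_assoc,
      mul_smul_comm, mul_sub, sub_mul, h0, mul_smul_comm, smul_mul_assoc, h1, h2]
    module

include hinv in
theorem evalad_tElt (p : PowerSeries ℂ) (θ i : ι) :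
    RCA.evalad b p ((1 / 2 : ℂ) • formIso P B hB (P.coroot i)) (tElt b B hB θ i) =
      (PowerSeries.coeff 0 p * (dualCoxeter b θ)⁻¹) • RCA.toCompletion b (RCA.hbar b) -
        (2 / rootNormSq P B hB i) • (RCA.toCompletion b (RCA.c b i) *
          RCA.evalx b p (formIso P B hB (P.coroot i)) *
          RCA.toCompletion b (RCA.w b (refl P i))) := by
  -- Placing ħ, c_α and s_α in degree zero does not change the value at 1 and aligns both sides
  -- coefficient by coefficient.
  have h0 (a : RCA b) : a ∈ RCA.fil b 0 := RCA.mem_filSpan_zero b a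
  have h (a : RCA b) := RCA.atOne_monomial b (h0 a)
  rw [← RCA.atOne_evalad, ← RCA.atOne_evalx, ← h, ← h, ← h, ← map_mul, ← map_mul,
    ← map_smul (RCA.atOne b), ← map_smul (RCA.atOne b), ← map_sub (RCA.atOne b)]
  congr 1
  refine Subtype.ext (PowerSeries.ext fun n => ?_)
  simp only [Subalgebra.coe_sub, Subalgebra.coe_smul, Subalgebra.coe_mul, pow_zero, mul_one,
    map_sub, coeff_smul', PowerSeries.coeff_mul_C, PowerSeries.coeff_C_mul, PowerSeries.coeff_mk,
    adx_iterate_tElt b hB hinv, PowerSeries.coeff_C]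
  rw [smul_sub, mul_smul_comm, smul_mul_assoc, ← mul_assoc, smul_comm (PowerSeries.coeff n p)]
  congr 1
  split_ifs with hn
  · rw [hn, smul_smul]
  · simp

/-- With e = e^{2πi α(z)}, πi (e + 1)/(e - 1) = πi + 2πi/(e - 1). On s_α the πi completes F to
`trigSeries`, giving φ(x(u)), and 2πi/(e - 1) gives the k_α s_α term. On ħ, where F(0) = 0, the
whole constant remains as the central term. -/
theorem limit_eq (θ : ι) {z : N} (hz : ∀ i, Complex.exp (twoPiI * P.root' i z) ≠ 1) (u : N) :
    heckeHom b hB hinv hsymm (akzCoeff b z u) +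
      (∑ i ∈ posRoots b, P.root' i u * ((Complex.exp (twoPiI * P.root' i z) + 1) /
        (Complex.exp (twoPiI * P.root' i z) - 1)) * (twoPiI / 2 / dualCoxeter b θ)) •
          RCA.toCompletion b (RCA.hbar b) =
      ∑ i ∈ posRoots b, P.root' i u • RCA.evalad b (oddTrig + PowerSeries.C (twoPiI / 2 *
        ((Complex.exp (twoPiI * P.root' i z) + 1) / (Complex.exp (twoPiI * P.root' i z) - 1))))
          ((1 / 2 : ℂ) • formIso P B hB (P.coroot i)) (tElt b B hB θ i) -
        RCA.toCompletion b (RCA.y b u) := by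
  rw [akzCoeff, map_add, map_smul, heckeHom_x, map_sum, Finset.sum_smul]
  have h (i : ι) : P.root' i u • RCA.evalad b (oddTrig + PowerSeries.C (twoPiI / 2 *
        ((Complex.exp (twoPiI * P.root' i z) + 1) / (Complex.exp (twoPiI * P.root' i z) - 1))))
          ((1 / 2 : ℂ) • formIso P B hB (P.coroot i)) (tElt b B hB θ i) =
      heckeHom b hB hinv hsymm
        ((twoPiI * P.root' i u / (Complex.exp (twoPiI * P.root' i z) - 1)) •
          (DAHA.k b i * DAHA.w b (refl P i))) -
      (P.root' i u * (2 / rootNormSq P B hB i)) •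
        (RCA.toCompletion b (RCA.c b i) * RCA.evalx b trigSeries (formIso P B hB (P.coroot i)) *
          RCA.toCompletion b (RCA.w b (refl P i))) +
      (P.root' i u * ((Complex.exp (twoPiI * P.root' i z) + 1) /
        (Complex.exp (twoPiI * P.root' i z) - 1)) * (twoPiI / 2 / dualCoxeter b θ)) •
          RCA.toCompletion b (RCA.hbar b) := by
    have he := sub_ne_zero.mpr (hz i)
    have hκ : oddTrig + PowerSeries.C (twoPiI / 2 * ((Complex.exp (twoPiI * P.root' i z) + 1) /
        (Complex.exp (twoPiI * P.root' i z) - 1))) = trigSeries +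
          PowerSeries.C (twoPiI / (Complex.exp (twoPiI * P.root' i z) - 1)) := by
      rw [trigSeries_eq, add_assoc, ← map_add]
      congr 2
      field_simp
      ring
    rw [evalad_tElt b hB hinv, map_add, coeff_zero_oddTrig, PowerSeries.coeff_zero_C, hκ,
      RCA.evalx_add_C, mul_add, add_mul (RCA.toCompletion b _ * _), mul_smul_comm, mul_one, smul_mul_assoc, map_smul, map_mul,
      heckeHom_k, heckeHom_w, ← neg_one_smul ℂ, smul_mul_assoc, smul_mul_assoc]
    generalize RCA.toCompletion b (RCA.c b i) *
      RCA.evalx b trigSeries (formIso P B hB (P.coroot i)) *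
        RCA.toCompletion b (RCA.w b (refl P i)) = S
    generalize RCA.toCompletion b (RCA.c b i) * RCA.toCompletion b (RCA.w b (refl P i)) = T
    module
  simp only [h, Finset.sum_add_distrib, Finset.sum_sub_distrib]
  abel

theorem tendsto_ellCoeff (θ : ι) {z : N} (hz : ∀ i, Complex.exp (twoPiI * P.root' i z) ≠ 1)
    (u : N) (n : ℕ) (l : Module.Dual ℂ (RCA b ⧸ RCA.fil b n)) :
    Tendsto (fun τ : ℍ => l ((ellCoeff b B hB θ τ z u).1 n)) UpperHalfPlane.atImInfty
      (𝓝 (l ((∑ i ∈ posRoots b, P.root' i u • RCA.evalad b (oddTrig + PowerSeries.C (twoPiI / 2 *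
        ((Complex.exp (twoPiI * P.root' i z) + 1) / (Complex.exp (twoPiI * P.root' i z) - 1))))
          ((1 / 2 : ℂ) • formIso P B hB (P.coroot i)) (tElt b B hB θ i) -
        RCA.toCompletion b (RCA.y b u) : RCA.completion b).1 n))) := by
  let L : RCA.completion b →ₗ[ℂ] ℂ :=
    l ∘ₗ LinearMap.proj n ∘ₗ (RCA.completion b).val.toLinearMap
  have hL (a : RCA.completion b) : l (a.1 n) = L a := rfl
  simp only [hL, ellCoeff, map_sub, map_sum, map_smul]
  exact (tendsto_finsetSum _ fun i _ =>
    (RCA.tendsto_evalad b (tendsto_coeff_kSeries (hz i)) _ _ n l).const_smul _).sub_const _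

end

end AffineKZ
end

/-! ### The main theorem -/

open AffineKZ in
theorem mainTheorem10 {ι M N : Type*} [Fintype ι] [AddCommGroup M] [Module ℂ M]
    [AddCommGroup N] [Module ℂ N] [FiniteDimensional ℂ N]
    (P : RootPairing ι ℂ M N) [P.IsCrystallographic] [P.IsReduced] [P.IsRootSystem]
    (b : P.Base) (B : LinearMap.BilinForm ℂ N) (hB : B.Nondegenerate) (hsymm : B.IsSymm)
    (hinv : ∀ (i : ι) (u v : N), B (P.coreflection i u) (P.coreflection i v) = B u v) :
    ∃ φ : DAHA b →ₐ[ℂ] RCA.completion b,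
      (∀ g : P.weylGroup, φ (DAHA.w b g) = RCA.toCompletion b (RCA.w b g)) ∧
      (∀ i : ι, φ (DAHA.k b i) =
        -((2 / rootNormSq P B hB i) • RCA.toCompletion b (RCA.c b i))) ∧
      (∀ u : N, twoPiI • φ (DAHA.x b u) = -RCA.toCompletion b (RCA.y b u) -
        ∑ i ∈ posRoots b, (P.root' i u * (2 / rootNormSq P B hB i)) •
          (RCA.toCompletion b (RCA.c b i) *
            RCA.evalx b trigSeries (formIso P B hB (P.coroot i)) *
            RCA.toCompletion b (RCA.w b (refl P i)))) ∧
      (∀ θ : ι, IsHighestRoot b θ → B (P.coroot θ) (P.coroot θ) = 2 →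
        ∀ z : N, (∀ i, Complex.exp (twoPiI * P.root' i z) ≠ 1) →
        ∀ (u : N) (n : ℕ) (l : Module.Dual ℂ (RCA b ⧸ RCA.fil b n)),
          Filter.Tendsto (fun τ : UpperHalfPlane => l ((ellCoeff b B hB θ τ z u).1 n))
            UpperHalfPlane.atImInfty
            (nhds (l ((φ (akzCoeff b z u) +
              (∑ i ∈ posRoots b, P.root' i u *
                ((Complex.exp (twoPiI * P.root' i z) + 1) /
                  (Complex.exp (twoPiI * P.root' i z) - 1)) *
                (twoPiI / 2 / dualCoxeter b θ)) •
                RCA.toCompletion b (RCA.hbar b)).1 n)))) := by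
  refine ⟨heckeHom b hB hinv hsymm, heckeHom_w b hB hinv hsymm, heckeHom_k b hB hinv hsymm,
    heckeHom_x b hB hinv hsymm, fun θ _ _ z hz u n l => ?_⟩
  rw [limit_eq b hB hinv hsymm θ hz]
  exact tendsto_ellCoeff b hB θ hz u n l
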